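/- Let $K$ be a field, $R=K[x_1,\dots,x_n]$ with its standard grading, and let $2\le\delta\le n-1$. Let $f_1,\dots,f_n\in R$ be a regular sequence of quadratic forms, put $\mathfrak f=(f_1,\dots,f_n)$ and $A=R/\mathfrak f$, and let $g_1,\dots,g_\delta\in R$ be quadratic forms such that $f_1,\dots,f_n,g_1,\dots,g_\delta$ are linearly independent over $K$; put $I=\mathfrak f+(g_1,\dots,g_\delta)$ (a defect-$\delta$ quadratic ideal). Suppose that some linear form annihilates $g_1,\dots,g_{\delta-1}$ in $A$ but does not annihilate $g_\delta$ in $A$. Then $$\dim_K I_3\ \ge\ \dim_K\mathcal L_3\ =\ n^2+n\delta-\frac{\delta(\delta+3)}{2},\qquad \mathcal L=(x_1^2,\dots,x_n^2)+(x_1x_2,x_1x_3,\dots,x_1x_{\delta+1}).$$ That is, the Eisenbud–Green–Harris condition in degree $2$ holds for $I$: there is an ideal $\mathcal P=(x_1^2,\dots,x_n^2)+J$ with $\dim_K I_2=\dim_K\mathcal P_2$ and $\dim_K I_3=\dim_K\mathcal P_3$, where $J$ is a lex ideal, i.e. a monomial ideal such that, for every $d$, $J_d$ is spanned over $K$ by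 an initial segment (beginning with the greatest monomial) of the monomials of degree $d$ in the lexicographic order with $x_1>\dots>x_n$. -/

import Mathlib

open MvPolynomial

noncomputable section

namespace EGH

variable {K : Type*} [Field K] {n : ℕ}

/-- The degree `d` component `I_d` of an ideal `I` of `K[x_1, …, x_n]`: the `K`-vector space of
the forms of degree `d` that lie in `I`. -/
def component (I : Ideal (MvPolynomial (Fin n) K)) (d : ℕ) :
    Submodule K (MvPolynomial (Fin n) K) :=
  I.restrictScalars K ⊓ homogeneousSubmodule (Fin n) K d

/-- The dimension `dim_K I_d` (a finite number, since `I_d` sits inside the finite-dimensional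
space of forms of degree `d`). -/
def hilb (I : Ideal (MvPolynomial (Fin n) K)) (d : ℕ) : ℕ :=
  Module.finrank K (component I d)

/-- `I = (f_1, …, f_n) + (g_1, …, g_δ)` is a defect `δ` quadratic ideal: the `f_i` and `g_j` are
quadratic forms, linearly independent over `K`, and `f_1, …, f_n` is a regular sequence. -/
structure IsDefectQuadratic {δ : ℕ} (f : Fin n → MvPolynomial (Fin n) K)
    (g : Fin δ → MvPolynomial (Fin n) K) (I : Ideal (MvPolynomial (Fin n) K)) : Prop where
  f_quadratic : ∀ i, (f i).IsHomogeneous 2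
  g_quadratic : ∀ j, (g j).IsHomogeneous 2
  regular : RingTheory.Sequence.IsRegular (MvPolynomial (Fin n) K) (List.ofFn f)
  linearIndependent : LinearIndependent K (Sum.elim f g)
  eq_sup : I = Ideal.span (Set.range f) ⊔ Ideal.span (Set.range g)

/-- `Ann_{A_1}(S)` for `A = R/𝔣`: the classes in `A` of linear forms that kill (the class in `A` of)
every element of `S`. -/
def linearAnn (𝔣 : Ideal (MvPolynomial (Fin n) K)) (S : Set (MvPolynomial (Fin n) K)) :
    Set (MvPolynomial (Fin n) K ⧸ 𝔣) :=
  {a | (∃ L : MvPolynomial (Fin n) K, L.IsHomogeneous 1 ∧ Ideal.Quotient.mk 𝔣 L = a) ∧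
    ∀ s ∈ S, a * Ideal.Quotient.mk 𝔣 s = 0}

/-- The ideal `(x_1^2, …, x_n^2) + (x_1 x_2, x_1 x_3, …, x_1 x_{δ+1})`; the variable `x_k` is
`X i` with `i = k - 1`. -/
def lppIdeal (K : Type*) [Field K] (n δ : ℕ) : Ideal (MvPolynomial (Fin n) K) :=
  Ideal.span (Set.range fun i : Fin n => (X i : MvPolynomial (Fin n) K) ^ 2) ⊔
    Ideal.span {p | ∃ i j : Fin n, (i : ℕ) = 0 ∧ 1 ≤ (j : ℕ) ∧ (j : ℕ) ≤ δ ∧ p = X i * X j}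

/-- A lex ideal: a monomial ideal `J` such that each `J_d` is spanned over `K` by an initial
segment (beginning with the greatest monomial) of the monomials of degree `d` in the lexicographic
order with `x_1 > x_2 > ⋯ > x_n`. -/
def IsLexIdeal (J : Ideal (MvPolynomial (Fin n) K)) : Prop :=
  (∃ M : Set (Fin n →₀ ℕ), J = Ideal.span ((fun u => monomial u (1 : K)) '' M)) ∧
  ∀ d : ℕ, ∃ S : Set (Fin n →₀ ℕ),
    (∀ u ∈ S, u.degree = d) ∧
    (∀ u ∈ S, ∀ v : Fin n →₀ ℕ, v.degree = d → toLex u < toLex v → v ∈ S) ∧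
    component J d = Submodule.span K ((fun u => monomial u (1 : K)) '' S)

/-- A lex-plus-powers ideal with respect to the exponents `a_1, …, a_n`:
an ideal `(x_1^{a_1}, …, x_n^{a_n}) + J` with `J` a lex ideal. -/
def IsLexPlusPowers (a : Fin n → ℕ) (P : Ideal (MvPolynomial (Fin n) K)) : Prop :=
  ∃ J : Ideal (MvPolynomial (Fin n) K), IsLexIdeal J ∧
    P = Ideal.span (Set.range fun i : Fin n => (X i : MvPolynomial (Fin n) K) ^ a i) ⊔ J

/-- The conclusion of the Eisenbud–Green–Harris conjecture in degrees `d` and `d + 1` for the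
ideal `I`: some lex-plus-powers ideal has the same Hilbert function as `I` in these degrees. -/
def SatisfiesEGH (a : Fin n → ℕ) (d : ℕ) (I : Ideal (MvPolynomial (Fin n) K)) : Prop :=
  ∃ P : Ideal (MvPolynomial (Fin n) K), IsLexPlusPowers a P ∧
    hilb I d = hilb P d ∧ hilb I (d + 1) = hilb P (d + 1)

end EGH

end

/-! Write 𝔣 for the ideal of the quadrics f_i. Multiplying the f_i and g_j by linear forms maps a
space of dimension n(n+δ) into I_3. A regular sequence of quadrics has no linear syzygies
(`linComb_eq_zero`), so the kernel of this map embeds in the space `linRel` of linear relations on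
the g_j modulo 𝔣. Everything rests on the bound δ(δ+3)/2 for its dimension (`finrank_linRel_le`).

Let l kill every g_j but the last one, and put δ = t+1. Multiplying a relation by l shows that its
last coefficient kills the cubic l·g_δ, which is nonzero modulo 𝔣; the linear forms doing so have
dimension at most 3 (`finrank_linearAnn_cubic_le`). When the last coefficient vanishes, what remains
is a relation on g_1, …, g_t, and these have dimension at most t(t+3)/2
(`finrank_linRel_of_annihilated_le`). The sum t(t+3)/2 + 3 is at most (t+1)(t+4)/2 because t ≥ 1.

Both estimates come from linkage. If q and l are non-zero-divisors modulo s and l·a ≡ c·q modulo s,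
then the class of a modulo s+(q) can be traded for the class of c modulo s+(l): nonvanishing and
annihilators persist, and for a quadric q and a linear form l the degree drops by one. Three such
trades turn the cubic into a nonzero constant. One trade turns the quadrics g_1, …, g_t into linear
forms, whose relations can be counted.

The trades need linear forms that are regular modulo parts of the quadric sequence. Over an infinite
field a general basis of the span of the f_i provides this (`exists_generic_basis`); any other field
is first extended to its algebraic closure. The existence of the lex-plus-powers ideal is then a
count of monomials. -/

/-! ### Exchange and linkage in regular sequences -/

section Exchange

variable {R : Type*} [CommRing R]

/-- `a` is a non-zero-divisor modulo the ideal `s`. -/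
def NzdMod (s : Ideal R) (a : R) : Prop := ∀ x, a * x ∈ s → x ∈ s

/-- The ideal `s + (t_0, …, t_{i-1})`. -/
def chainIdeal (s : Ideal R) (t : ℕ → R) : ℕ → Ideal R
  | 0 => s
  | i + 1 => chainIdeal s t i ⊔ Ideal.span {t i}

/-- `t_0, …, t_{k-1}` is a weakly regular sequence modulo `s`. -/
def IsNzdChain (s : Ideal R) (t : ℕ → R) (k : ℕ) : Prop :=
  ∀ i < k, NzdMod (chainIdeal s t i) (t i)

@[simp] theorem chainIdeal_zero (s : Ideal R) (t : ℕ → R) : chainIdeal s t 0 = s := rfl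

theorem chainIdeal_succ (s : Ideal R) (t : ℕ → R) (i : ℕ) :
    chainIdeal s t (i + 1) = chainIdeal s t i ⊔ Ideal.span {t i} := rfl

theorem chainIdeal_eq (s : Ideal R) (t : ℕ → R) (k : ℕ) :
    chainIdeal s t k = s ⊔ Ideal.span (Set.range fun i : Fin k => t i) := by
  induction k with
  | zero => simp
  | succ k ih =>
    rw [chainIdeal_succ, ih, sup_assoc, ← Ideal.span_union]
    congr 2
    ext x
    simp only [Set.mem_union, Set.mem_range, Set.mem_singleton_iff]
    constructor
    · rintro (⟨i, rfl⟩ | rfl)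
      · exact ⟨i.castSucc, rfl⟩
      · exact ⟨Fin.last k, rfl⟩
    · rintro ⟨i, rfl⟩
      induction i using Fin.lastCases with
      | last => right; rfl
      | cast i => left; exact ⟨i, rfl⟩

theorem chainIdeal_congr {s : Ideal R} {t t' : ℕ → R} {k : ℕ} (h : ∀ i < k, t i = t' i) :
    chainIdeal s t k = chainIdeal s t' k := by
  induction k with
  | zero => rfl
  | succ k ih =>
    rw [chainIdeal_succ, chainIdeal_succ, ih fun i hi => h i (by omega), h k (by omega)]

theorem chainIdeal_sup (s : Ideal R) (t : ℕ → R) (J : Ideal R) (k : ℕ) :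
    chainIdeal (s ⊔ J) t k = chainIdeal s t k ⊔ J := by
  rw [chainIdeal_eq, chainIdeal_eq, sup_right_comm]

theorem chainIdeal_comm (s : Ideal R) (t t' : ℕ → R) (k l : ℕ) :
    chainIdeal (chainIdeal s t k) t' l = chainIdeal (chainIdeal s t' l) t k := by
  simp only [chainIdeal_eq, sup_right_comm]

theorem le_chainIdeal (s : Ideal R) (t : ℕ → R) (k : ℕ) : s ≤ chainIdeal s t k := by
  rw [chainIdeal_eq]; exact le_sup_left

theorem mem_chainIdeal (s : Ideal R) (t : ℕ → R) {k i : ℕ} (h : i < k) :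
    t i ∈ chainIdeal s t k := by
  rw [chainIdeal_eq]
  exact Ideal.mem_sup_right (Ideal.subset_span ⟨⟨i, h⟩, rfl⟩)

theorem chainIdeal_le {s J : Ideal R} {t : ℕ → R} {k : ℕ} (hs : s ≤ J) (ht : ∀ i < k, t i ∈ J) :
    chainIdeal s t k ≤ J := by
  rw [chainIdeal_eq]
  refine sup_le hs (Ideal.span_le.2 ?_)
  rintro _ ⟨i, rfl⟩
  exact ht i i.2

theorem chainIdeal_append (s : Ideal R) (t t' : ℕ → R) (j p : ℕ) :
    chainIdeal s (fun i => if i < j then t i else t' (i - j)) (j + p) =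
      chainIdeal (chainIdeal s t j) t' p := by
  induction p with
  | zero =>
    exact chainIdeal_congr fun i hi => if_pos hi
  | succ p ih =>
    rw [← add_assoc, chainIdeal_succ, ih, chainIdeal_succ]
    simp

theorem IsNzdChain.append {s : Ideal R} {t t' : ℕ → R} {j p : ℕ} (ht : IsNzdChain s t j)
    (ht' : IsNzdChain (chainIdeal s t j) t' p) :
    IsNzdChain s (fun i => if i < j then t i else t' (i - j)) (j + p) := by
  intro i hi
  by_cases hij : i < j
  · have := ht i hij
    rw [chainIdeal_congr (t' := t) fun a ha => if_pos (ha.trans hij)]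
    simpa only [if_pos hij] using this
  · obtain ⟨a, rfl⟩ := Nat.exists_eq_add_of_le (not_lt.1 hij)
    rw [chainIdeal_append]
    simpa only [if_neg hij, Nat.add_sub_cancel_left] using ht' a (by omega)

theorem IsNzdChain.mono {s : Ideal R} {t : ℕ → R} {k l : ℕ} (h : IsNzdChain s t l) (hkl : k ≤ l) :
    IsNzdChain s t k := fun i hi => h i (hi.trans_le hkl)

theorem NzdMod.swap {s : Ideal R} {a b : R} (ha : NzdMod s a)
    (hb : NzdMod (s ⊔ Ideal.span {a}) b) : NzdMod (s ⊔ Ideal.span {b}) a := by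
  intro c hc
  obtain ⟨x, hx, y, hy, hxy⟩ := Submodule.mem_sup.1 hc
  obtain ⟨d, rfl⟩ := Ideal.mem_span_singleton'.1 hy
  have h1 : b * d ∈ s ⊔ Ideal.span {a} := by
    have : b * d = -x + c * a := by linear_combination hxy
    rw [this]
    exact Submodule.add_mem_sup (neg_mem hx) (Ideal.mem_span_singleton'.2 ⟨c, rfl⟩)
  obtain ⟨z, hz, w, hw, hzw⟩ := Submodule.mem_sup.1 (hb d h1)
  obtain ⟨e, rfl⟩ := Ideal.mem_span_singleton'.1 hw
  have h2 : a * (c - b * e) ∈ s := by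
    have : a * (c - b * e) = x + b * z := by linear_combination -hxy - b * hzw
    rw [this]
    exact add_mem hx (Ideal.mul_mem_left _ _ hz)
  have : c = (c - b * e) + e * b := by ring
  rw [this]
  exact Submodule.add_mem_sup (ha _ h2) (Ideal.mem_span_singleton'.2 ⟨e, rfl⟩)

/-- Half of the linkage principle: were c ≡ e·l modulo s, the relation would read l·(a - e·q) ∈ s,
and cancelling l would put a in s + (q). -/
theorem NzdMod.link_notMem {s : Ideal R} {l q a c : R} (hl : NzdMod s l)
    (ha : a ∉ s ⊔ Ideal.span {q}) (hc : l * a - c * q ∈ s) : c ∉ s ⊔ Ideal.span {l} := by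
  intro h
  obtain ⟨x, hx, y, hy, rfl⟩ := Submodule.mem_sup.1 h
  obtain ⟨e, rfl⟩ := Ideal.mem_span_singleton'.1 hy
  have h2 : l * (a - e * q) ∈ s := by
    have : l * (a - e * q) = (l * a - (x + e * l) * q) + q * x := by ring
    rw [this]
    exact add_mem hc (Ideal.mul_mem_left _ _ hx)
  apply ha
  have : a = (a - e * q) + e * q := by ring
  rw [this]
  exact Submodule.add_mem_sup (hl _ h2) (Ideal.mem_span_singleton'.2 ⟨e, rfl⟩)

/-- If `∑ v_j a_j ∈ s + (q)` and `l a_j ≡ c_j q` modulo `s`, then `∑ v_j c_j ∈ s + (l)`. -/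
theorem NzdMod.link_sum_mem {ι : Type*} {s : Ideal R} {l q : R} {a c v : ι → R} {T : Finset ι}
    (hq : NzdMod s q) (hc : ∀ j ∈ T, l * a j - c j * q ∈ s)
    (hv : ∑ j ∈ T, v j * a j ∈ s ⊔ Ideal.span {q}) :
    ∑ j ∈ T, v j * c j ∈ s ⊔ Ideal.span {l} := by
  obtain ⟨x, hx, y, hy, hxy⟩ := Submodule.mem_sup.1 hv
  obtain ⟨b, rfl⟩ := Ideal.mem_span_singleton'.1 hy
  have h1 : ∑ j ∈ T, v j * (l * a j - c j * q) ∈ s :=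
    Ideal.sum_mem _ fun j hj => Ideal.mul_mem_left _ _ (hc j hj)
  have h2 : ∑ j ∈ T, v j * (l * a j - c j * q) =
      l * ∑ j ∈ T, v j * a j - q * ∑ j ∈ T, v j * c j := by
    rw [Finset.mul_sum, Finset.mul_sum, ← Finset.sum_sub_distrib]
    exact Finset.sum_congr rfl fun j _ => by ring
  have h3 : q * (∑ j ∈ T, v j * c j - b * l) ∈ s := by
    have : q * (∑ j ∈ T, v j * c j - b * l) =
        l * x - ∑ j ∈ T, v j * (l * a j - c j * q) := by
      rw [h2]; linear_combination -l * hxy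
    rw [this]
    exact sub_mem (Ideal.mul_mem_left _ _ hx) h1
  have : ∑ j ∈ T, v j * c j = (∑ j ∈ T, v j * c j - b * l) + b * l := by ring
  rw [this]
  exact Submodule.add_mem_sup (hq _ h3) (Ideal.mem_span_singleton'.2 ⟨b, rfl⟩)

/-- The other half of linkage: annihilators of a modulo q still annihilate c modulo l. -/
theorem NzdMod.link_mem {s : Ideal R} {l q a c v : R} (hq : NzdMod s q)
    (hc : l * a - c * q ∈ s) (hv : v * a ∈ s ⊔ Ideal.span {q}) :
    v * c ∈ s ⊔ Ideal.span {l} := by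
  have := NzdMod.link_sum_mem (T := {()}) (a := fun _ => a) (c := fun _ => c) (v := fun _ => v)
    hq (fun _ _ => hc) (by simpa using hv)
  simpa using this

theorem IsNzdChain.sup_span {s : Ideal R} {t : ℕ → R} {k : ℕ} {l : R} (ht : IsNzdChain s t k)
    (hl : ∀ i, i ≤ k → NzdMod (chainIdeal s t i) l) : IsNzdChain (s ⊔ Ideal.span {l}) t k := by
  intro i hi
  rw [chainIdeal_sup]
  exact (ht i hi).swap (hl (i + 1) hi)

end Exchange

/-! ### General elements over an infinite field -/

section Generic

variable {K R : Type*} [Field K] [Infinite K] [CommRing R] [Algebra K R] [IsNoetherianRing R]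

/-- Prime avoidance for subspaces. The zero-divisors modulo each J i form a finite union of
associated primes; none contains F, since such a prime is the annihilator of a nonzero class. Over
an infinite field F is not a finite union of proper subspaces. -/
theorem exists_nzdMod_of_finite (F : Submodule K R) {ι : Type*} (T : Finset ι) (J : ι → Ideal R)
    (h : ∀ i ∈ T, ∀ c, (∀ x ∈ F, x * c ∈ J i) → c ∈ J i) :
    ∃ l ∈ F, ∀ i ∈ T, NzdMod (J i) l := by
  classical
  let S : Finset (Submodule K F) := T.biUnion fun i =>
    (associatedPrimes.finite R (R ⧸ J i)).toFinset.image
      fun P => (P.restrictScalars K).comap F.subtype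
  have htop : ⊤ ∉ S := by
    intro hS
    simp only [S, Finset.mem_biUnion, Finset.mem_image, Set.Finite.mem_toFinset] at hS
    obtain ⟨i, hi, P, hP, hPtop⟩ := hS
    rw [AssociatedPrimes.mem_iff, isAssociatedPrime_iff] at hP
    obtain ⟨hprime, y, rfl⟩ := hP
    obtain ⟨c, rfl⟩ := Ideal.Quotient.mk_surjective y
    have hc : c ∈ J i := by
      refine h i hi c fun x hx => ?_
      have hx' : (⟨x, hx⟩ : F) ∈ (⊤ : Submodule K F) := trivial
      rw [← hPtop] at hx'
      have h1 : x ∈ Submodule.colon (⊥ : Submodule R (R ⧸ J i)) {Ideal.Quotient.mk (J i) c} := hx'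
      rw [Submodule.mem_colon_singleton, Submodule.mem_bot] at h1
      rw [← Ideal.Quotient.eq_zero_iff_mem, map_mul]
      exact h1
    apply hprime.ne_top
    rw [Ideal.Quotient.eq_zero_iff_mem.2 hc]
    simp
  obtain ⟨l, hl⟩ := (Set.ne_univ_iff_exists_notMem _).1
    (Subspace.biUnion_ne_univ_of_top_notMem htop)
  refine ⟨l, l.2, fun i hi x hx => ?_⟩
  have hreg : (l : R) ∈ {r : R | IsSMulRegular (R ⧸ J i) r} := by
    by_contra hcon
    have h1 : (l : R) ∈ {r : R | IsSMulRegular (R ⧸ J i) r}ᶜ := hcon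
    rw [← biUnion_associatedPrimes_eq_compl_regular] at h1
    obtain ⟨P, hP, hlP⟩ := Set.mem_iUnion₂.1 h1
    apply hl
    refine Set.mem_iUnion₂.2 ⟨(P.restrictScalars K).comap F.subtype, ?_, hlP⟩
    simp only [S, Finset.mem_biUnion, Finset.mem_image, Set.Finite.mem_toFinset]
    exact ⟨i, hi, P, hP, rfl⟩
  have := isSMulRegular_iff_right_eq_zero_of_smul.1 hreg (Ideal.Quotient.mk _ x) (by
    have h2 := Ideal.Quotient.eq_zero_iff_mem.2 hx
    rwa [map_mul] at h2)
  exact Ideal.Quotient.eq_zero_iff_mem.1 this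

/-- If a space `F` contains a weakly regular sequence modulo `s` that is longer than `t`, then no
nonzero element modulo `s + (t)` is killed by `F`. -/
theorem IsNzdChain.mem_of_forall_mul_mem (F : Submodule K R) {i m : ℕ} (him : i < m)
    {s : Ideal R} {t f : ℕ → R} (ht : IsNzdChain s t i) (hf : IsNzdChain s f m)
    (hfF : ∀ a < m, f a ∈ F) {c : R} (hc : ∀ x ∈ F, x * c ∈ chainIdeal s t i) :
    c ∈ chainIdeal s t i := by
  induction i using Nat.strong_induction_on generalizing m s c with
  | _ i ih =>
  rcases i with _ | i
  · exact hf 0 him c (hc _ (hfF 0 him))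
  -- A general l in F is regular modulo all proper initial parts of both sequences: for those of t
  -- by induction, for those of f because f itself supplies regular elements of F.
  obtain ⟨l, hlF, hl⟩ := exists_nzdMod_of_finite F
    (Finset.univ : Finset (Fin (i + 1) ⊕ Fin m))
    (Sum.elim (fun a => chainIdeal s t a) fun a => chainIdeal s f a) (by
      rintro (a | a) - d hd
      · exact ih a a.2 (by omega) (ht.mono (by omega)) hf hfF hd
      · exact hf a a.2 d (hd _ (hfF a a.2)))
  have hlt : ∀ a, a ≤ i → NzdMod (chainIdeal s t a) l := fun a ha =>
    hl (Sum.inl ⟨a, by omega⟩) (Finset.mem_univ _)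
  have hlf : ∀ a, a < m → NzdMod (chainIdeal s f a) l := fun a ha =>
    hl (Sum.inr ⟨a, ha⟩) (Finset.mem_univ _)
  by_contra hcn
  obtain ⟨x, hx, y, hy, hxy⟩ := Submodule.mem_sup.1 (hc l hlF)
  obtain ⟨d, rfl⟩ := Ideal.mem_span_singleton'.1 hy
  have hd : l * c - d * t i ∈ chainIdeal s t i := by
    rw [← hxy, add_sub_cancel_right]; exact hx
  -- Linkage replaces t i by l and c by d. If F kills d modulo s + (l) and the shorter t, induction
  -- puts d in that ideal, contradicting linkage.
  refine (hlt i le_rfl).link_notMem hcn hd ?_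
  rw [← chainIdeal_sup]
  -- The element l takes one place, so f loses its last term; the strict inequality of lengths
  -- survives because t is shortened as well.
  have hf' : IsNzdChain (s ⊔ Ideal.span {l}) f (m - 1) :=
    (hf.mono (by omega)).sup_span fun a ha => hlf a (by omega)
  refine ih i (by omega) (by omega) ((ht.mono (by omega)).sup_span hlt) hf'
    (fun a ha => hfF a (by omega)) fun v hv => ?_
  rw [chainIdeal_sup]
  exact (ht i (by omega)).link_mem hd (hc v hv)

/-- A general sequence in a space `F` that contains a weakly regular sequence of length `n` is
weakly regular modulo all the initial parts of a given weakly regular sequence `t`. -/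
theorem IsNzdChain.exists_generic (F : Submodule K R) {k n : ℕ} {s : Ideal R} {t f : ℕ → R}
    (ht : IsNzdChain s t k) (hf : IsNzdChain s f n) (hfF : ∀ a < n, f a ∈ F) :
    ∃ f' : ℕ → R, (∀ i < n, f' i ∈ F) ∧
      ∀ j ≤ k, IsNzdChain (chainIdeal s t j) f' (n - j) := by
  suffices H : ∀ p ≤ n, ∃ f' : ℕ → R, (∀ i < p, f' i ∈ F) ∧
      ∀ j ≤ k, ∀ i < p, i + j < n → NzdMod (chainIdeal (chainIdeal s t j) f' i) (f' i) by
    obtain ⟨f', h1, h2⟩ := H n le_rfl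
    exact ⟨f', h1, fun j hj i hi => h2 j hj i (by omega) (by omega)⟩
  intro p
  induction p with
  | zero => exact fun _ => ⟨f, by simp, by simp⟩
  | succ p ih =>
    intro hp
    obtain ⟨f', h1, h2⟩ := ih (by omega)
    -- One l must serve every j with p + j < n: the first j terms of t followed by the p terms
    -- already chosen form a sequence shorter than f, so F kills no nonzero class modulo it.
    obtain ⟨l, hlF, hl⟩ := exists_nzdMod_of_finite F ((Finset.range (k + 1)).filter (p + · < n))
      (fun j => chainIdeal (chainIdeal s t j) f' p) (by
        intro j hj d hd
        simp only [Finset.mem_filter, Finset.mem_range] at hj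
        rw [← chainIdeal_append] at hd ⊢
        refine IsNzdChain.mem_of_forall_mul_mem F (by omega) (m := n) ?_ hf hfF hd
        exact (ht.mono (by omega)).append fun i hi => h2 j (by omega) i hi (by omega))
    have hne : ∀ i < p, Function.update f' p l i = f' i := fun i hi =>
      Function.update_of_ne (by omega) _ _
    refine ⟨Function.update f' p l, fun i hi => ?_, fun j hj i hi hij => ?_⟩
    · rcases Nat.lt_succ_iff_lt_or_eq.1 hi with hi | rfl
      · rw [hne i hi]; exact h1 i hi
      · rwa [Function.update_self]
    · rw [chainIdeal_congr (t' := f') fun a ha => hne a (by omega)]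
      rcases Nat.lt_succ_iff_lt_or_eq.1 hi with hi | rfl
      · rw [hne i hi]; exact h2 j hj i hi hij
      · rw [Function.update_self]
        exact hl j (by simp only [Finset.mem_filter, Finset.mem_range]; omega)

omit [Infinite K] [IsNoetherianRing R] [Algebra K R] in
-- Induction on i: t j is moved past one general element at a time by `NzdMod.swap`.
theorem IsNzdChain.nzdMod_of_generic {k n : ℕ} {s : Ideal R} {t f : ℕ → R}
    (ht : IsNzdChain s t k) (hf : ∀ j ≤ k, IsNzdChain (chainIdeal s t j) f (n - j))
    {j i : ℕ} (hj : j < k) (hij : i + j < n) :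
    NzdMod (chainIdeal (chainIdeal s t j) f i) (t j) := by
  induction i with
  | zero => exact ht j hj
  | succ i ih =>
    refine (ih (by omega)).swap ?_
    have := hf (j + 1) hj i (by omega)
    rwa [chainIdeal_succ, chainIdeal_sup] at this

end Generic

/-! ### Linear independence modulo an ideal -/

section Independent

variable {K R : Type*} [Field K] [CommRing R] [Algebra K R]

theorem linearIndependent_of_notMem_chainIdeal {s : Ideal R} {h : ℕ → R} {m : ℕ}
    (hh : ∀ i < m, h i ∉ chainIdeal s h i) :
    LinearIndependent K fun i : Fin m => Ideal.Quotient.mkₐ K s (h i) := by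
  induction m with
  | zero => exact linearIndependent_empty_type
  | succ m ih =>
    rw [linearIndependent_finSucc']
    refine ⟨ih fun i hi => hh i (by omega), fun hmem => hh m (by omega) ?_⟩
    have hle : Submodule.span K (Set.range (Fin.init fun i : Fin (m + 1) =>
        Ideal.Quotient.mkₐ K s (h i))) ≤
        (Submodule.map (Ideal.Quotient.mkₐ K s).toLinearMap
          ((chainIdeal s h m).restrictScalars K)) := by
      rw [Submodule.span_le]
      rintro _ ⟨i, rfl⟩
      exact ⟨h i, mem_chainIdeal s h i.2, rfl⟩
    obtain ⟨x, hx, hxm⟩ := hle hmem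
    have : h m - x ∈ s := by
      rw [← Ideal.Quotient.eq_zero_iff_mem, map_sub, sub_eq_zero]
      exact hxm.symm
    have h2 := add_mem (le_chainIdeal s h m this) hx
    rwa [sub_add_cancel] at h2

theorem NzdMod.notMem {s : Ideal R} {a : R} (h : NzdMod s a) (hs : s ≠ ⊤) : a ∉ s := fun ha =>
  hs ((Ideal.eq_top_iff_one _).2 (h 1 (by rwa [mul_one])))

end Independent

/-! ### Homogeneous ideals and degree arguments -/

section Graded

variable {K : Type*} [Field K] {n : ℕ}

theorem homogeneousComponent_mul_of_isHomogeneous {c q : MvPolynomial (Fin n) K} {d e : ℕ}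
    (hq : q.IsHomogeneous e) :
    homogeneousComponent (d + e) (c * q) = homogeneousComponent d c * q := by
  conv_lhs => rw [← sum_homogeneousComponent c, Finset.sum_mul, map_sum]
  have h : ∀ i, homogeneousComponent (d + e) (homogeneousComponent i c * q) =
      if i = d then homogeneousComponent d c * q else 0 := by
    intro i
    rw [homogeneousComponent_of_mem (((homogeneousComponent_isHomogeneous i c).mul hq))]
    by_cases hi : i = d
    · simp [hi]
    · rw [if_neg hi, if_neg (by omega)]
  simp only [h, Finset.sum_ite_eq']
  split_ifs with hd
  · rfl
  · rw [homogeneousComponent_eq_zero, zero_mul]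
    simpa using hd

theorem homogeneousComponent_mul_eq_zero {c q : MvPolynomial (Fin n) K} {d e : ℕ}
    (hq : q.IsHomogeneous e) (hd : d < e) : homogeneousComponent d (c * q) = 0 := by
  rw [← sum_homogeneousComponent c, Finset.sum_mul, map_sum]
  refine Finset.sum_eq_zero fun i _ => ?_
  rw [homogeneousComponent_of_mem (((homogeneousComponent_isHomogeneous i c).mul hq)),
    if_neg (by omega)]

/-- An ideal containing the homogeneous components of its elements. -/
def IsHomogeneousIdeal (I : Ideal (MvPolynomial (Fin n) K)) : Prop :=
  ∀ d, ∀ p ∈ I, homogeneousComponent d p ∈ I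

theorem isHomogeneousIdeal_bot : IsHomogeneousIdeal (⊥ : Ideal (MvPolynomial (Fin n) K)) := by
  intro d p hp
  rw [Ideal.mem_bot] at hp ⊢
  rw [hp, map_zero]

theorem IsHomogeneousIdeal.sup {I J : Ideal (MvPolynomial (Fin n) K)} (hI : IsHomogeneousIdeal I)
    (hJ : IsHomogeneousIdeal J) : IsHomogeneousIdeal (I ⊔ J) := by
  intro d p hp
  obtain ⟨x, hx, y, hy, rfl⟩ := Submodule.mem_sup.1 hp
  rw [map_add]
  exact Submodule.add_mem_sup (hI d x hx) (hJ d y hy)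

theorem MvPolynomial.IsHomogeneous.isHomogeneousIdeal_span {q : MvPolynomial (Fin n) K} {e : ℕ}
    (hq : q.IsHomogeneous e) : IsHomogeneousIdeal (Ideal.span {q}) := by
  intro d p hp
  obtain ⟨c, rfl⟩ := Ideal.mem_span_singleton'.1 hp
  by_cases hd : d < e
  · rw [homogeneousComponent_mul_eq_zero hq hd]; exact zero_mem _
  · obtain ⟨a, rfl⟩ := Nat.exists_eq_add_of_le' (not_lt.1 hd)
    rw [homogeneousComponent_mul_of_isHomogeneous hq]
    exact Ideal.mem_span_singleton'.2 ⟨_, rfl⟩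

theorem IsHomogeneousIdeal.chainIdeal {s : Ideal (MvPolynomial (Fin n) K)}
    {t : ℕ → MvPolynomial (Fin n) K} (hs : IsHomogeneousIdeal s) {k e : ℕ}
    (ht : ∀ i < k, (t i).IsHomogeneous e) : IsHomogeneousIdeal (chainIdeal s t k) := by
  induction k with
  | zero => exact hs
  | succ k ih =>
    rw [chainIdeal_succ]
    exact (ih fun i hi => ht i (by omega)).sup (ht k (by omega)).isHomogeneousIdeal_span

/-- Homogeneous elements of `s + (q)` have homogeneous quotients by `q`. -/
theorem IsHomogeneousIdeal.exists_isHomogeneous_sub_mem {s : Ideal (MvPolynomial (Fin n) K)}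
    (hs : IsHomogeneousIdeal s) {p q : MvPolynomial (Fin n) K} {d e : ℕ}
    (hp : p.IsHomogeneous (d + e)) (hq : q.IsHomogeneous e) (h : p ∈ s ⊔ Ideal.span {q}) :
    ∃ c : MvPolynomial (Fin n) K, c.IsHomogeneous d ∧ p - c * q ∈ s := by
  obtain ⟨x, hx, y, hy, hxy⟩ := Submodule.mem_sup.1 h
  obtain ⟨c, rfl⟩ := Ideal.mem_span_singleton'.1 hy
  refine ⟨homogeneousComponent d c, homogeneousComponent_isHomogeneous d c, ?_⟩
  have h1 := congrArg (homogeneousComponent (d + e)) hxy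
  rw [map_add, homogeneousComponent_mul_of_isHomogeneous hq, homogeneousComponent_of_mem hp,
    if_pos rfl] at h1
  rw [← h1, add_sub_cancel_right]
  exact hs _ x hx

theorem exists_isHomogeneous_of_mem_span_range {ι : Type*} [Fintype ι]
    {f : ι → MvPolynomial (Fin n) K} {d e : ℕ} (hf : ∀ i, (f i).IsHomogeneous e)
    {p : MvPolynomial (Fin n) K} (hp : p.IsHomogeneous (d + e))
    (h : p ∈ Ideal.span (Set.range f)) :
    ∃ c : ι → MvPolynomial (Fin n) K, (∀ i, (c i).IsHomogeneous d) ∧ ∑ i, c i * f i = p := by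
  obtain ⟨c, rfl⟩ := Ideal.mem_span_range_iff_exists_fun.1 h
  refine ⟨fun i => homogeneousComponent d (c i), fun i => homogeneousComponent_isHomogeneous d _, ?_⟩
  have h1 : homogeneousComponent (d + e) (∑ i, c i * f i) = ∑ i, c i * f i := by
    rw [homogeneousComponent_of_mem hp, if_pos rfl]
  conv_rhs => rw [← h1, map_sum]
  exact Finset.sum_congr rfl fun i _ => (homogeneousComponent_mul_of_isHomogeneous (hf i)).symm

theorem exists_C_of_isHomogeneous_zero {p : MvPolynomial (Fin n) K} (hp : p.IsHomogeneous 0) :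
    ∃ a : K, p = C a :=
  ⟨_, totalDegree_eq_zero_iff_eq_C.1 ((totalDegree_zero_iff_isHomogeneous _).2 hp)⟩

/-- In the degree e of the generators v i, only their scalar multiples contribute beyond the part
coming from s. -/
theorem mem_span_of_mem_chainIdeal {s : Ideal (MvPolynomial (Fin n) K)}
    {v : ℕ → MvPolynomial (Fin n) K} {k e : ℕ} (hv : ∀ i < k, (v i).IsHomogeneous e)
    {V : Submodule K (MvPolynomial (Fin n) K)} (hs : ∀ p ∈ s, homogeneousComponent e p ∈ V)
    {p : MvPolynomial (Fin n) K} (h : p ∈ chainIdeal s v k) :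
    homogeneousComponent e p ∈ V ⊔ Submodule.span K (Set.range fun i : Fin k => v i) := by
  rw [chainIdeal_eq] at h
  obtain ⟨x, hx, y, hy, rfl⟩ := Submodule.mem_sup.1 h
  rw [map_add]
  refine Submodule.add_mem_sup (hs x hx) ?_
  obtain ⟨c, rfl⟩ := Ideal.mem_span_range_iff_exists_fun.1 hy
  rw [map_sum]
  refine Submodule.sum_mem _ fun i _ => ?_
  have h1 := homogeneousComponent_mul_of_isHomogeneous (c := c i) (d := 0) (hv i i.2)
  rw [zero_add] at h1
  obtain ⟨a, ha⟩ := exists_C_of_isHomogeneous_zero (homogeneousComponent_isHomogeneous 0 (c i))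
  rw [h1, ha, C_mul']
  exact Submodule.smul_mem _ _ (Submodule.subset_span ⟨i, rfl⟩)

theorem homogeneousComponent_eq_zero_of_mem_chainIdeal {f : ℕ → MvPolynomial (Fin n) K} {m d e : ℕ}
    (hf : ∀ i < m, (f i).IsHomogeneous e) (hd : d < e) {p : MvPolynomial (Fin n) K}
    (h : p ∈ chainIdeal ⊥ f m) : homogeneousComponent d p = 0 := by
  rw [chainIdeal_eq, bot_sup_eq] at h
  obtain ⟨c, rfl⟩ := Ideal.mem_span_range_iff_exists_fun.1 h
  rw [map_sum]
  exact Finset.sum_eq_zero fun i _ => homogeneousComponent_mul_eq_zero (hf i i.2) hd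

theorem chainIdeal_le_ker_constantCoeff {s : Ideal (MvPolynomial (Fin n) K)} {t : ℕ → MvPolynomial (Fin n) K}
    {k e : ℕ} (he : 0 < e) (ht : ∀ i < k, (t i).IsHomogeneous e)
    (hs : s ≤ RingHom.ker (constantCoeff (σ := Fin n) (R := K))) :
    chainIdeal s t k ≤ RingHom.ker (constantCoeff (σ := Fin n) (R := K)) :=
  chainIdeal_le hs fun i hi => (ht i hi).coeff_eq_zero (by simpa using he.ne)

theorem ne_top_of_le_ker_constantCoeff {s : Ideal (MvPolynomial (Fin n) K)}
    (hs : s ≤ RingHom.ker (constantCoeff (σ := Fin n) (R := K))) : s ≠ ⊤ := by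
  rintro rfl
  exact RingHom.ker_ne_top _ (top_le_iff.1 hs)

end Graded

/-! ### Independent linear forms are a regular sequence -/

section LinearForms

variable {K : Type*} [Field K] {n : ℕ}

/-- The linear form with the given coefficients. -/
noncomputable def linForm : (Fin n → K) →ₗ[K] MvPolynomial (Fin n) K :=
  Fintype.linearCombination K X

theorem linForm_apply (v : Fin n → K) : linForm v = ∑ i, v i • (X i : MvPolynomial (Fin n) K) :=
  rfl

theorem linForm_isHomogeneous (v : Fin n → K) : (linForm v).IsHomogeneous 1 := by
  rw [linForm_apply]
  refine IsHomogeneous.sum _ _ _ fun i _ => ?_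
  rw [smul_eq_C_mul]
  simpa using (isHomogeneous_C (Fin n) (v i)).mul (isHomogeneous_X K i)

theorem linForm_injective : Function.Injective (linForm (K := K) (n := n)) :=
  linearIndependent_iff_injective_fintypeLinearCombination.1 (linearIndependent_X (Fin n) K)

theorem exists_linForm_eq {p : MvPolynomial (Fin n) K} (hp : p.IsHomogeneous 1) :
    ∃ v, linForm v = p := by
  have h : p ∈ Submodule.span K (Set.range (X : Fin n → MvPolynomial (Fin n) K)) := by
    rw [← homogeneousSubmodule_one_eq_span_X]; exact hp
  obtain ⟨v, hv⟩ := (Submodule.mem_span_range_iff_exists_fun K).1 h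
  exact ⟨v, hv⟩

theorem nzdMod_span_X {σ : Type*} {S : Set σ} {j : σ} (hj : j ∉ S) :
    NzdMod (Ideal.span (X '' S : Set (MvPolynomial σ K))) (X j) := by
  classical
  intro y hy
  rw [mem_ideal_span_X_image] at hy ⊢
  intro m hm
  obtain ⟨i, hi, h⟩ := hy (Finsupp.single j 1 + m) (by
    rw [mem_support_iff, coeff_X_mul]
    exact mem_support_iff.1 hm)
  refine ⟨i, hi, ?_⟩
  rwa [Finsupp.add_apply, Finsupp.single_eq_of_ne (by rintro rfl; exact hj hi), zero_add] at h

/-- The linear change of variables attached to a basis of the space of linear forms. -/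
noncomputable def linFormEquiv {ι : Type*} (b : Module.Basis ι K (Fin n → K)) :
    MvPolynomial ι K ≃ₐ[K] MvPolynomial (Fin n) K := by
  let L : (Fin n → K) →ₗ[K] MvPolynomial ι K := b.constr K X
  have hL : ∀ i, L (b i) = X i := fun i => b.constr_basis K X i
  let φ : MvPolynomial ι K →ₐ[K] MvPolynomial (Fin n) K := aeval fun i => linForm (b i)
  let ψ : MvPolynomial (Fin n) K →ₐ[K] MvPolynomial ι K := aeval fun i => L (Pi.single i 1)
  have h1 : φ.toLinearMap ∘ₗ L = linForm := b.ext fun i => by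
    rw [LinearMap.comp_apply, hL]; simp [φ]
  have h2 : ψ.toLinearMap ∘ₗ linForm = L := LinearMap.pi_ext' fun i => by
    ext
    simp [ψ, linForm_apply, Pi.single_apply]
  refine AlgEquiv.ofAlgHom φ ψ (algHom_ext fun i => ?_) (algHom_ext fun i => ?_)
  · have := LinearMap.congr_fun h1 (Pi.single i 1)
    simp [linForm_apply, Pi.single_apply] at this
    simpa [ψ] using this
  · have := LinearMap.congr_fun h2 (b i)
    rw [hL] at this
    simpa [φ] using this

theorem linFormEquiv_X {ι : Type*} (b : Module.Basis ι K (Fin n → K)) (i : ι) :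
    linFormEquiv b (X i) = linForm (b i) := by
  simp [linFormEquiv]

/-- A linear change of coordinates turns the forms into distinct variables, and a variable is
regular modulo an ideal generated by other variables. -/
theorem linForm_isNzdChain {k : ℕ} {v : ℕ → Fin n → K}
    (hv : LinearIndependent K fun i : Fin k => v i) :
    IsNzdChain ⊥ (fun i => linForm (v i)) k := by
  intro i hi x hx
  have hr := hv.linearIndepOn_id
  let b := Module.Basis.extend hr
  have hmem : ∀ a (_ : a < k), v a ∈ hr.extend (Set.subset_univ _) := fun a ha =>
    hr.subset_extend _ ⟨⟨a, ha⟩, rfl⟩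
  let e := linFormEquiv b
  have he : ∀ a (ha : a < k), e (X ⟨v a, hmem a ha⟩) = linForm (v a) := fun a ha => by
    simp only [e, linFormEquiv_X, b, Module.Basis.extend_apply_self]
  let S : Set (hr.extend (Set.subset_univ _)) := Set.range fun a : Fin i =>
    ⟨v a, hmem a (a.2.trans hi)⟩
  have hS : Ideal.map e.toRingEquiv.toRingHom (Ideal.span (X '' S)) =
      chainIdeal ⊥ (fun i => linForm (v i)) i := by
    rw [chainIdeal_eq, bot_sup_eq, Ideal.map_span, ← Set.image_comp, ← Set.range_comp]
    congr 2
    funext a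
    exact he a (a.2.trans hi)
  have hj : (⟨v i, hmem i hi⟩ : hr.extend (Set.subset_univ _)) ∉ S := by
    rintro ⟨a, ha⟩
    have h1 : v a = v i := congrArg Subtype.val ha
    have h2 := hv.injective (a₁ := ⟨a, a.2.trans hi⟩) (a₂ := ⟨i, hi⟩) h1
    have h3 : (a : ℕ) = i := congrArg Fin.val h2
    exact absurd h3 a.2.ne
  rw [← hS] at hx ⊢
  obtain ⟨y, rfl⟩ := e.surjective x
  have key : ∀ z, e z ∈ Ideal.map e.toRingEquiv.toRingHom (Ideal.span (X '' S)) ↔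
      z ∈ Ideal.span (X '' S) := by
    intro z
    constructor
    · intro hz
      obtain ⟨w, hw, hwz⟩ := (Ideal.mem_map_iff_of_surjective e.toRingEquiv.toRingHom
        e.surjective).1 hz
      rwa [← e.injective hwz]
    · exact fun hz => Ideal.mem_map_of_mem _ hz
  beta_reduce at hx
  rw [← he i hi, ← map_mul, key] at hx
  rw [key]
  exact nzdMod_span_X hj y hx

end LinearForms

/-! ### A rank-nullity estimate -/

section FinrankBound

theorem Submodule.finrank_le_add_of_maps {K M N P : Type*} [Field K] [AddCommGroup M] [Module K M]
    [AddCommGroup N] [Module K N] [AddCommGroup P] [Module K P] (T : Submodule K M)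
    (π : M →ₗ[K] N) (ρ : M →ₗ[K] P) (W : Submodule K N) (T₀ : Submodule K P)
    [FiniteDimensional K T] [FiniteDimensional K W] [FiniteDimensional K T₀]
    (hπ : ∀ a ∈ T, π a ∈ W) (hρ : ∀ a ∈ T, π a = 0 → ρ a ∈ T₀)
    (hinj : ∀ a ∈ T, π a = 0 → ρ a = 0 → a = 0) :
    Module.finrank K T ≤ Module.finrank K T₀ + Module.finrank K W := by
  let φ : T →ₗ[K] W := π.restrict hπ
  let ψ : LinearMap.ker φ →ₗ[K] T₀ :=
    ((ρ ∘ₗ T.subtype) ∘ₗ (LinearMap.ker φ).subtype).codRestrict T₀ fun a =>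
      hρ a.1 a.1.2 (congrArg Subtype.val a.2)
  have hψ : Function.Injective ψ := by
    rw [injective_iff_map_eq_zero]
    intro a ha
    exact Subtype.ext (Subtype.ext (hinj a.1 a.1.2 (congrArg Subtype.val a.2)
      (congrArg Subtype.val ha)))
  have h1 := LinearMap.finrank_range_add_finrank_ker φ
  have h2 := LinearMap.finrank_le_finrank_of_injective hψ
  have h3 := Submodule.finrank_le (LinearMap.range φ)
  omega

end FinrankBound

/-! ### Spaces of linear relations -/

section Relations

variable {K : Type*} [Field K] {n : ℕ}

/-- `(a_j) ↦ ∑ a_j g_j` for linear forms `a_j`. -/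
noncomputable def linComb {t : ℕ} (g : Fin t → MvPolynomial (Fin n) K) :
    (Fin t → Fin n → K) →ₗ[K] MvPolynomial (Fin n) K :=
  ∑ j, LinearMap.mulRight K (g j) ∘ₗ linForm ∘ₗ LinearMap.proj j

theorem linComb_apply {t : ℕ} (g : Fin t → MvPolynomial (Fin n) K) (a : Fin t → Fin n → K) :
    linComb g a = ∑ j, linForm (a j) * g j := by
  simp [linComb]

/-- The space of linear relations on the `g_j` modulo the ideal `J`. -/
noncomputable def linRel (J : Ideal (MvPolynomial (Fin n) K)) {t : ℕ}
    (g : Fin t → MvPolynomial (Fin n) K) : Submodule K (Fin t → Fin n → K) :=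
  (J.restrictScalars K).comap (linComb g)

theorem mem_linRel {J : Ideal (MvPolynomial (Fin n) K)} {t : ℕ}
    {g : Fin t → MvPolynomial (Fin n) K} {a : Fin t → Fin n → K} :
    a ∈ linRel J g ↔ ∑ j, linForm (a j) * g j ∈ J := by
  rw [linRel, Submodule.mem_comap, linComb_apply, Submodule.restrictScalars_mem]

theorem finrank_linRel_succ_le {J : Ideal (MvPolynomial (Fin n) K)} {t : ℕ}
    {g : Fin (t + 1) → MvPolynomial (Fin n) K} {W : Submodule K (Fin n → K)}
    (hW : ∀ a ∈ linRel J g, a (Fin.last t) ∈ W) :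
    Module.finrank K (linRel J g) ≤
      Module.finrank K (linRel J fun j => g j.castSucc) + Module.finrank K W := by
  refine Submodule.finrank_le_add_of_maps _ (LinearMap.proj (Fin.last t))
    (LinearMap.funLeft K (Fin n → K) Fin.castSucc) W _ hW (fun a ha h0 => ?_) fun a _ h0 h1 => ?_
  · rw [mem_linRel, Fin.sum_univ_castSucc] at ha
    have h0' : a (Fin.last t) = 0 := h0
    rw [h0', map_zero, zero_mul, add_zero] at ha
    exact mem_linRel.2 ha
  · funext j
    induction j using Fin.lastCases with
    | last => exact h0
    | cast j => exact congrFun h1 j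

/-- In a relation on w 1, …, w (t+1) modulo w 0, regularity forces the last coefficient into the
span of w 0, …, w t. Removing the coefficients one by one gives 1 + 2 + ⋯ + t for t forms. -/
theorem finrank_linRel_span_le {t : ℕ} {w : ℕ → Fin n → K}
    (hw : LinearIndependent K fun i : Fin (t + 1) => w i) :
    2 * Module.finrank K (linRel (Ideal.span {linForm (w 0)})
      fun j : Fin t => linForm (w (j + 1))) ≤ t * (t + 1) := by
  induction t with
  | zero =>
    have : linRel (Ideal.span {linForm (w 0)}) (fun j : Fin 0 => linForm (w (j + 1))) = ⊥ :=
      Subsingleton.elim _ _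
    simp [this]
  | succ t ih =>
    have ih := ih (hw.comp Fin.castSucc (Fin.castSucc_injective _))
    have hs : chainIdeal ⊥ (fun i => linForm (w i)) 1 = Ideal.span {linForm (w 0)} := by
      rw [chainIdeal_succ, chainIdeal_zero, bot_sup_eq]
    have h1 := finrank_linRel_succ_le (J := Ideal.span {linForm (w 0)})
      (g := fun j : Fin (t + 1) => linForm (w (j + 1)))
      (W := Submodule.span K (Set.range fun i : Fin (t + 1) => w i)) (by
        intro a ha
        rw [mem_linRel, Fin.sum_univ_castSucc] at ha
        have h2 : linForm (a (Fin.last t)) ∈ chainIdeal ⊥ (fun i => linForm (w i)) (t + 1) := by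
          refine linForm_isNzdChain hw (t + 1) (by omega) _ ?_
          have h3 : ∑ j : Fin t, linForm (a j.castSucc) * linForm (w (j + 1)) ∈
              chainIdeal ⊥ (fun i => linForm (w i)) (t + 1) :=
            Ideal.sum_mem _ fun j _ => Ideal.mul_mem_left _ _
              (mem_chainIdeal (i := j + 1) ⊥ (fun i => linForm (w i)) (by omega))
          have h4 : Ideal.span {linForm (w 0)} ≤ chainIdeal ⊥ (fun i => linForm (w i)) (t + 1) := by
            rw [Ideal.span_singleton_le_iff_mem]
            exact mem_chainIdeal ⊥ (fun i => linForm (w i)) (by omega)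
          have h5 := sub_mem (h4 ha) h3
          simp only [Fin.val_castSucc, add_sub_cancel_left, Fin.val_last] at h5
          rwa [mul_comm]
        have h6 := mem_span_of_mem_chainIdeal (e := 1) (V := ⊥)
          (fun i _ => linForm_isHomogeneous (w i)) (by simp) h2
        rw [homogeneousComponent_of_mem (linForm_isHomogeneous _), if_pos rfl, bot_sup_eq] at h6
        have h7 : (Set.range fun i : Fin (t + 1) => linForm (w i)) =
            linForm '' (Set.range fun i : Fin (t + 1) => w i) := by
          rw [← Set.range_comp]; rfl
        rw [h7, ← Submodule.map_span] at h6
        obtain ⟨y, hy, hya⟩ := h6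
        rwa [← linForm_injective hya])
    have h2 : Module.finrank K (Submodule.span K (Set.range fun i : Fin (t + 1) => w i)) ≤ t + 1 := by
      simpa [Set.finrank] using finrank_range_le_card (R := K) fun i : Fin (t + 1) => w i
    simp only [Fin.val_castSucc] at h1
    nlinarith

end Relations

/-! ### The relation bounds over an infinite field -/

section Infinite

variable {K : Type*} [Field K] [Infinite K] {n : ℕ}

/-- A general choice in the span of the f i generates the same ideal, and its initial parts combine
with initial parts of the linear forms, in total length at most m, with the regularity that linkage
requires. -/
theorem exists_generic_basis {f : ℕ → MvPolynomial (Fin n) K} {k m e : ℕ}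
    (hf : IsNzdChain ⊥ f m) (hfh : ∀ i < m, (f i).IsHomogeneous e) (he : 0 < e)
    {v : ℕ → Fin n → K} (hv : LinearIndependent K fun i : Fin k => v i)
    (hk : 0 < k) :
    ∃ f' : ℕ → MvPolynomial (Fin n) K, (∀ i < m, (f' i).IsHomogeneous e) ∧
      chainIdeal ⊥ f' m = chainIdeal ⊥ f m ∧
      (∀ j ≤ k, IsNzdChain (chainIdeal ⊥ (fun i => linForm (v i)) j) f' (m - j)) ∧
      ∀ j < k, ∀ i, i + j < m →
        NzdMod (chainIdeal (chainIdeal ⊥ (fun i => linForm (v i)) j) f' i) (linForm (v j)) := by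
  let F : Submodule K (MvPolynomial (Fin n) K) := Submodule.span K (Set.range fun i : Fin m => f i)
  have hFh : F ≤ homogeneousSubmodule (Fin n) K e := by
    rw [Submodule.span_le]
    rintro _ ⟨i, rfl⟩
    exact hfh i i.2
  have hv' := linForm_isNzdChain hv
  obtain ⟨f', hf'F, hf'⟩ := hv'.exists_generic F hf
    fun i hi => Submodule.subset_span ⟨⟨i, hi⟩, rfl⟩
  have hf'h : ∀ i < m, (f' i).IsHomogeneous e := fun i hi => hFh (hf'F i hi)
  have hnot : ∀ i < m, f' i ∉ chainIdeal ⊥ f' i := fun i hi =>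
    NzdMod.notMem (hf' 0 (by omega) i (by omega)) <| ne_top_of_le_ker_constantCoeff <|
      chainIdeal_le_ker_constantCoeff he (fun a ha => hf'h a (by omega)) bot_le
  have hli : LinearIndependent K fun i : Fin m => f' i :=
    LinearIndependent.of_comp (Ideal.Quotient.mkₐ K ⊥).toLinearMap
      (linearIndependent_of_notMem_chainIdeal hnot)
  -- The m general elements are independent in a space of dimension at most m, hence span it.
  have hspan : Submodule.span K (Set.range fun i : Fin m => f' i) = F := by
    have : FiniteDimensional K F := FiniteDimensional.span_of_finite K (Set.finite_range _)
    refine Submodule.eq_of_le_of_finrank_le (Submodule.span_le.2 ?_) ?_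
    · rintro _ ⟨i, rfl⟩
      exact hf'F i i.2
    · rw [finrank_span_eq_card hli]
      exact finrank_range_le_card (R := K) fun i : Fin m => f i
  refine ⟨f', hf'h, le_antisymm ?_ ?_, hf', fun j hj i hij =>
    hv'.nzdMod_of_generic hf' hj hij⟩
  · refine chainIdeal_le bot_le fun i hi => ?_
    have h1 : F ≤ (chainIdeal ⊥ f m).restrictScalars K := by
      rw [Submodule.span_le]
      rintro _ ⟨i, rfl⟩
      exact mem_chainIdeal ⊥ f i.2
    exact h1 (hf'F i hi)
  · refine chainIdeal_le bot_le fun i hi => ?_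
    have h1 : F ≤ (chainIdeal ⊥ f' m).restrictScalars K := by
      rw [← hspan, Submodule.span_le]
      rintro _ ⟨i, rfl⟩
      exact mem_chainIdeal ⊥ f' i.2
    exact h1 (Submodule.subset_span ⟨⟨i, hi⟩, rfl⟩)

omit [Infinite K] in
theorem exists_link {s : Ideal (MvPolynomial (Fin n) K)} (hs : IsHomogeneousIdeal s)
    {q l c : MvPolynomial (Fin n) K} {d : ℕ} (hq : q.IsHomogeneous 2) (hl : l.IsHomogeneous 1)
    (hc : c.IsHomogeneous (d + 1)) (hsq : NzdMod s q) (hsl : NzdMod s l)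
    (hcn : c ∉ s ⊔ Ideal.span {q}) (hlc : l * c ∈ s ⊔ Ideal.span {q}) :
    ∃ c' : MvPolynomial (Fin n) K, c'.IsHomogeneous d ∧ c' ∉ s ⊔ Ideal.span {l} ∧
      ∀ w, w * c ∈ s ⊔ Ideal.span {q} → w * c' ∈ s ⊔ Ideal.span {l} := by
  have h1 : (l * c).IsHomogeneous (d + 2) := by
    have := hl.mul hc
    rwa [show 1 + (d + 1) = d + 2 by omega] at this
  obtain ⟨c', hc', h⟩ := hs.exists_isHomogeneous_sub_mem h1 hq hlc
  exact ⟨c', hc', hsl.link_notMem hcn h, fun w hw => hsq.link_mem h hw⟩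

/-- Four independent annihilators would allow three linkages, each trading a quadric for a linear
form and lowering the degree of c. A nonzero constant killed by the fourth form would remain, making
that form dependent on the other three. -/
theorem finrank_linearAnn_cubic_le {f : ℕ → MvPolynomial (Fin n) K} 
    (hf : IsNzdChain ⊥ f n) (hfh : ∀ i < n, (f i).IsHomogeneous 2)
    {c : MvPolynomial (Fin n) K} (hc : c.IsHomogeneous 3) (hcn : c ∉ chainIdeal ⊥ f n)
    {W : Submodule K (Fin n → K)} (hW : ∀ v ∈ W, linForm v * c ∈ chainIdeal ⊥ f n) :
    Module.finrank K W ≤ 3 := by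
  by_contra hcon
  obtain ⟨u, hu⟩ := exists_linearIndependent_of_le_finrank (show 4 ≤ Module.finrank K W by omega)
  obtain ⟨v, hv⟩ : ∃ v : ℕ → Fin n → K, ∀ i : Fin 4, v i = u i :=
    ⟨fun i => if h : i < 4 then u ⟨i, h⟩ else 0, fun i => by simp⟩
  have hvi : LinearIndependent K fun i : Fin 4 => v i := by
    have h := hu.map' W.subtype (Submodule.ker_subtype W)
    simp only [hv]
    exact h
  have hvW : ∀ i < 4, v i ∈ W := fun i hi => by
    rw [hv ⟨i, hi⟩]; exact (u ⟨i, hi⟩).2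
  have hn : 4 ≤ n := by simpa using hvi.fintype_card_le_finrank
  obtain ⟨N, rfl⟩ := Nat.exists_eq_add_of_le' hn
  obtain ⟨f', hf'h, hf'eq, hf', hvn⟩ := exists_generic_basis hf hfh (by omega) hvi (by omega)
  rw [← hf'eq] at hcn hW
  set T : ℕ → ℕ → Ideal (MvPolynomial (Fin (N + 4)) K) := fun j i =>
    chainIdeal (chainIdeal ⊥ (fun i => linForm (v i)) j) f' i with hT
  have hstep : ∀ j i d c, j < 4 → i + 1 + j = N + 4 → c.IsHomogeneous (d + 1) → c ∉ T j (i + 1) →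
      linForm (v j) * c ∈ T j (i + 1) → ∃ c', c'.IsHomogeneous d ∧ c' ∉ T (j + 1) i ∧
        ∀ w, w * c ∈ T j (i + 1) → w * c' ∈ T (j + 1) i := by
    intro j i d c hj hij hc hcn hlc
    have h1 : T (j + 1) i = T j i ⊔ Ideal.span {linForm (v j)} := chainIdeal_sup _ _ _ _
    rw [h1]
    exact exists_link ((isHomogeneousIdeal_bot.chainIdeal
      fun i _ => linForm_isHomogeneous (v i)).chainIdeal fun a ha => hf'h a (by omega))
      (hf'h i (by omega)) (linForm_isHomogeneous _) hc (hf' j hj.le i (by omega))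
      (hvn j hj i (by omega)) hcn hlc
  -- The degrees run 3, 2, 1, 0, and the number of quadrics runs N + 4, N + 3, N + 2, N + 1.
  obtain ⟨c₁, hc₁, hn₁, hm₁⟩ := hstep 0 (N + 3) 2 c (by omega) (by omega) hc hcn
    (hW _ (hvW 0 (by omega)))
  obtain ⟨c₂, hc₂, hn₂, hm₂⟩ := hstep 1 (N + 2) 1 c₁ (by omega) (by omega) hc₁ hn₁
    (hm₁ _ (hW _ (hvW 1 (by omega))))
  obtain ⟨c₃, hc₃, hn₃, hm₃⟩ := hstep 2 (N + 1) 0 c₂ (by omega) (by omega) hc₂ hn₂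
    (hm₂ _ (hm₁ _ (hW _ (hvW 2 (by omega)))))
  have h3 := hm₃ _ (hm₂ _ (hm₁ _ (hW _ (hvW 3 (by omega)))))
  obtain ⟨a, rfl⟩ := exists_C_of_isHomogeneous_zero hc₃
  have ha : a ≠ 0 := by
    rintro rfl
    exact hn₃ (by rw [C_0]; exact zero_mem _)
  have h4 : linForm (v 3) ∈ T 3 (N + 1) := by
    have := Ideal.mul_mem_right (C a⁻¹) _ h3
    rwa [mul_assoc, ← C_mul, mul_inv_cancel₀ ha, C_1, mul_one] at this
  rw [hT] at h4
  beta_reduce at h4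
  rw [chainIdeal_comm] at h4
  -- The quadrics contribute nothing in degree 1, so v 3 would lie in the span of v 0, v 1, v 2.
  have h5 := mem_span_of_mem_chainIdeal (e := 1) (V := ⊥)
    (fun i _ => linForm_isHomogeneous (v i)) (fun p hp => by
      rw [Submodule.mem_bot]
      exact homogeneousComponent_eq_zero_of_mem_chainIdeal (fun i hi => hf'h i (by omega))
        one_lt_two hp) h4
  rw [homogeneousComponent_of_mem (linForm_isHomogeneous _), if_pos rfl, bot_sup_eq] at h5
  have h6 := hvi.map' linForm (LinearMap.ker_eq_bot.2 linForm_injective)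
  rw [linearIndependent_finSucc'] at h6
  exact h6.2 h5

/-- Passing from w 0 to all of w 0, …, w t costs at most t terms of a general regular sequence in F.
The remaining N - t stay independent modulo the linear forms, which leaves at most t dimensions for
the kernel. -/
theorem finrank_inf_chainIdeal_le {F : Submodule K (MvPolynomial (Fin n) K)}
    [FiniteDimensional K F] {N t : ℕ} {h : ℕ → MvPolynomial (Fin n) K} {w : ℕ → Fin n → K}
    (hw : LinearIndependent K fun i : Fin (t + 1) => w i)
    (hh : IsNzdChain (Ideal.span {linForm (w 0)}) h N) (hhF : ∀ i < N, h i ∈ F)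
    (hF2 : F ≤ homogeneousSubmodule (Fin n) K 2)
    (hF : Module.finrank K F ≤ N) (htN : t ≤ N) :
    Module.finrank K (F ⊓ (chainIdeal ⊥ (fun i => linForm (w i)) (t + 1)).restrictScalars K :
      Submodule K (MvPolynomial (Fin n) K)) ≤ t := by
  set J := chainIdeal ⊥ (fun i => linForm (w i)) (t + 1) with hJ
  have hshift : ∀ i, chainIdeal (Ideal.span {linForm (w 0)}) (fun i => linForm (w (i + 1))) i =
      chainIdeal ⊥ (fun i => linForm (w i)) (i + 1) := by
    intro i
    induction i with
    | zero => rw [chainIdeal_succ, chainIdeal_zero, chainIdeal_zero, bot_sup_eq]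
    | succ i ih => rw [chainIdeal_succ, ih, ← chainIdeal_succ]
  have hw' : IsNzdChain (Ideal.span {linForm (w 0)}) (fun i => linForm (w (i + 1))) t := by
    intro i hi
    rw [hshift]
    exact linForm_isNzdChain hw (i + 1) (by omega)
  obtain ⟨h', hh'F, hh'⟩ := hw'.exists_generic F hh hhF
  have hc := hh' t le_rfl
  rw [hshift, ← hJ] at hc
  have hnot : ∀ i < N - t, h' i ∉ chainIdeal J h' i := fun i hi =>
    (hc i hi).notMem <| ne_top_of_le_ker_constantCoeff <|
      chainIdeal_le_ker_constantCoeff two_pos (fun a ha => hF2 (hh'F a (by omega))) <|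
        chainIdeal_le_ker_constantCoeff one_pos (fun i _ => linForm_isHomogeneous _) bot_le
  have hli := linearIndependent_of_notMem_chainIdeal (K := K) hnot
  let φ : F →ₗ[K] MvPolynomial (Fin n) K ⧸ J := (Ideal.Quotient.mkₐ K J).toLinearMap ∘ₗ F.subtype
  have h1 := LinearMap.finrank_range_add_finrank_ker φ
  have h2 : N - t ≤ Module.finrank K (LinearMap.range φ) := by
    rw [← Fintype.card_fin (N - t), ← finrank_span_eq_card hli]
    refine Submodule.finrank_mono (Submodule.span_le.2 ?_)
    rintro _ ⟨i, rfl⟩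
    exact ⟨⟨h' i, hh'F i (by omega)⟩, rfl⟩
  have h3 : Module.finrank K (F ⊓ J.restrictScalars K : Submodule K (MvPolynomial (Fin n) K)) ≤
      Module.finrank K (LinearMap.ker φ) := by
    let ψ : (F ⊓ J.restrictScalars K : Submodule K (MvPolynomial (Fin n) K)) →ₗ[K]
        LinearMap.ker φ := (Submodule.inclusion inf_le_left).codRestrict _ fun x =>
      Ideal.Quotient.eq_zero_iff_mem.2 x.2.2
    refine LinearMap.finrank_le_finrank_of_injective (f := ψ) fun x y hxy => ?_
    exact Subtype.ext (congrArg (fun z => (z.1 : MvPolynomial (Fin n) K)) hxy)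
  omega

/-- A relation modulo w 0 and the quadrics equates, modulo w 0, a combination of the w (j+1) with an
element of the span F of the quadrics. That element lies in F ∩ (w 0, …, w t), of dimension at most
t; when it is zero, a relation modulo w 0 alone is left. -/
theorem finrank_linRel_chainIdeal_le {N t : ℕ} {h : ℕ → MvPolynomial (Fin n) K}
    {w : ℕ → Fin n → K} (hw : LinearIndependent K fun i : Fin (t + 1) => w i)
    (hh : IsNzdChain (Ideal.span {linForm (w 0)}) h N) (hh2 : ∀ i < N, (h i).IsHomogeneous 2)
    (htN : t ≤ N) :
    2 * Module.finrank K (linRel (chainIdeal (Ideal.span {linForm (w 0)}) h N)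
      fun j : Fin t => linForm (w (j + 1))) ≤ t * (t + 3) := by
  set s := Ideal.span {linForm (w 0)} with hs
  set u : Fin t → MvPolynomial (Fin n) K := fun j => linForm (w (j + 1)) with hu
  let F : Submodule K (MvPolynomial (Fin n) K) := Submodule.span K (Set.range fun i : Fin N => h i)
  have : FiniteDimensional K F := FiniteDimensional.span_of_finite K (Set.finite_range _)
  have hF2 : F ≤ homogeneousSubmodule (Fin n) K 2 := by
    rw [Submodule.span_le]
    rintro _ ⟨i, rfl⟩
    exact hh2 i i.2
  have hFN : Module.finrank K F ≤ N := by
    simpa [Set.finrank] using finrank_range_le_card (R := K) fun i : Fin N => h i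
  have hhF : ∀ i < N, h i ∈ F := fun i hi => Submodule.subset_span ⟨⟨i, hi⟩, rfl⟩
  have hC := finrank_inf_chainIdeal_le hw hh hhF hF2 hFN htN
  have hY := finrank_linRel_span_le hw
  set J := chainIdeal ⊥ (fun i => linForm (w i)) (t + 1) with hJ
  have hsJ : s ≤ J := by
    rw [hs, Ideal.span_singleton_le_iff_mem]
    exact mem_chainIdeal ⊥ (fun i => linForm (w i)) (by omega)
  let T : Submodule K ((Fin t → Fin n → K) × F) :=
    (s.restrictScalars K).comap (linComb u ∘ₗ LinearMap.fst K _ _ -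
      F.subtype ∘ₗ LinearMap.snd K _ _)
  have hT : ∀ x ∈ T, ∑ j, linForm (x.1 j) * u j - (x.2 : MvPolynomial (Fin n) K) ∈ s := by
    intro x hx
    have : linComb u x.1 - (x.2 : MvPolynomial (Fin n) K) ∈ s := hx
    rwa [linComb_apply] at this
  have : FiniteDimensional K (F ⊓ J.restrictScalars K : Submodule K (MvPolynomial (Fin n) K)) :=
    Submodule.finiteDimensional_inf_left _ _
  have h1 : Module.finrank K T ≤ Module.finrank K (linRel s u) +
      Module.finrank K (F ⊓ J.restrictScalars K : Submodule K (MvPolynomial (Fin n) K)) := by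
    refine Submodule.finrank_le_add_of_maps T (F.subtype ∘ₗ LinearMap.snd K _ _)
      (LinearMap.fst K _ _) _ _ (fun x hx => ⟨x.2.2, ?_⟩) (fun x hx h0 => ?_) fun x _ h0 h1 => ?_
    · have h2 : ∑ j, linForm (x.1 j) * u j ∈ J := Ideal.sum_mem _ fun j _ =>
        Ideal.mul_mem_left _ _ (mem_chainIdeal (i := j + 1) ⊥ (fun i => linForm (w i)) (by omega))
      have h3 := sub_mem h2 (hsJ (hT x hx))
      rwa [sub_sub_cancel] at h3
    · have h2 := hT x hx
      have h0' : (x.2 : MvPolynomial (Fin n) K) = 0 := h0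
      rw [h0', sub_zero] at h2
      exact mem_linRel.2 h2
    · exact Prod.ext h1 (Subtype.ext h0)
  have h2 : Module.finrank K (linRel (chainIdeal s h N) u) ≤ Module.finrank K T := by
    have h3 : linRel (chainIdeal s h N) u ≤ T.map (LinearMap.fst K _ _) := by
      intro a ha
      rw [mem_linRel] at ha
      have h4 := mem_span_of_mem_chainIdeal (V := s.restrictScalars K) hh2
        (fun p hp => (linForm_isHomogeneous (w 0)).isHomogeneousIdeal_span 2 p hp) ha
      rw [homogeneousComponent_of_mem (IsHomogeneous.sum _ _ 2 fun j _ =>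
        (linForm_isHomogeneous (a j)).mul (linForm_isHomogeneous (w (j + 1)))), if_pos rfl] at h4
      obtain ⟨x, hx, y, hy, hxy⟩ := Submodule.mem_sup.1 h4
      refine ⟨(a, ⟨y, hy⟩), ?_, rfl⟩
      change linComb u a - y ∈ s
      rw [linComb_apply, ← hxy, add_sub_cancel_right]
      exact hx
    exact (Submodule.finrank_mono h3).trans (Submodule.finrank_map_le _ _)
  -- The count is t(t+1)/2 + t = t(t+3)/2.
  nlinarith

/-- One quadric f' N is traded for l. Writing l·g_j ≡ u_j·f' N modulo the other quadrics, relations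
on the g_j become relations on the linear forms u_j modulo l and the other quadrics, with the same
coefficients. -/
theorem finrank_linRel_of_annihilated_le {f : ℕ → MvPolynomial (Fin n) K}
    (hf : IsNzdChain ⊥ f n) (hfh : ∀ i < n, (f i).IsHomogeneous 2) {t : ℕ} (ht : t + 1 ≤ n)
    {g : Fin t → MvPolynomial (Fin n) K} (hg : ∀ j, (g j).IsHomogeneous 2)
    (hgi : LinearIndependent K fun j => Ideal.Quotient.mkₐ K (chainIdeal ⊥ f n) (g j))
    {l : Fin n → K} (hl : l ≠ 0) (hlg : ∀ j, linForm l * g j ∈ chainIdeal ⊥ f n) :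
    2 * Module.finrank K (linRel (chainIdeal ⊥ f n) g) ≤ t * (t + 3) := by
  obtain ⟨N, rfl⟩ : ∃ N, n = N + 1 := ⟨n - 1, by omega⟩
  have hv : LinearIndependent K fun _ : Fin 1 => l := LinearIndependent.of_subsingleton 0 hl
  obtain ⟨f', hf'h, hf'eq, hf', hvn⟩ := exists_generic_basis (v := fun _ => l) hf hfh two_pos hv
    one_pos
  rw [← hf'eq] at hgi hlg ⊢
  have hs : IsHomogeneousIdeal (chainIdeal ⊥ f' N) :=
    isHomogeneousIdeal_bot.chainIdeal fun i hi => hf'h i (by omega)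
  have hsq : NzdMod (chainIdeal ⊥ f' N) (f' N) := hf' 0 (by omega) N (by omega)
  have hsl : NzdMod (chainIdeal ⊥ f' N) (linForm l) := hvn 0 one_pos N (by omega)
  have hlink : ∀ j, ∃ u, linForm l * g j - linForm u * f' N ∈ chainIdeal ⊥ f' N := fun j => by
    obtain ⟨c, hc, h⟩ := hs.exists_isHomogeneous_sub_mem (d := 1) (e := 2)
      ((linForm_isHomogeneous l).mul (hg j)) (hf'h N (by omega)) (hlg j)
    obtain ⟨u, rfl⟩ := exists_linForm_eq hc
    exact ⟨u, h⟩
  choose u hu using hlink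
  obtain ⟨w, hw0, hwu⟩ : ∃ w : ℕ → Fin (N + 1) → K, w 0 = l ∧ ∀ j : Fin t, w (j + 1) = u j :=
    ⟨fun i => if h : 1 ≤ i ∧ i ≤ t then u ⟨i - 1, by omega⟩ else l, by simp, fun j => by simp⟩
  have hwi : LinearIndependent K fun i : Fin (t + 1) => w i := by
    rw [Fintype.linearIndependent_iff]
    intro r hr
    rw [Fin.sum_univ_succ] at hr
    simp only [Fin.val_zero, Fin.val_succ, hw0, hwu] at hr
    -- A dependence between l and the u_j puts ∑ r_j u_j in (l); by linkage ∑ r_j g_j then vanishes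
    -- modulo the quadrics, so the independence of the g_j applies.
    have h1 : ∑ j : Fin t, r j.succ • g j ∈ chainIdeal ⊥ f' (N + 1) := by
      by_contra hcon
      refine hsl.link_notMem hcon (c := linForm (∑ j : Fin t, r j.succ • u j)) ?_ ?_
      · rw [Finset.mul_sum, map_sum, Finset.sum_mul, ← Finset.sum_sub_distrib]
        refine Ideal.sum_mem _ fun j _ => ?_
        rw [map_smul, smul_mul_assoc, mul_smul_comm, ← smul_sub]
        exact Submodule.smul_of_tower_mem _ _ (hu j)
      · rw [← eq_neg_iff_add_eq_zero, eq_comm, neg_eq_iff_eq_neg] at hr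
        rw [hr, ← neg_smul, map_smul, smul_eq_C_mul]
        exact Ideal.mem_sup_right (Ideal.mem_span_singleton'.2 ⟨_, rfl⟩)
    have h2 : ∀ j : Fin t, r j.succ = 0 := by
      refine Fintype.linearIndependent_iff.1 hgi (fun j => r j.succ) ?_
      simp only [← map_smul, ← map_sum]
      exact Ideal.Quotient.eq_zero_iff_mem.2 h1
    intro i
    induction i using Fin.cases with
    | zero =>
      simp only [h2, zero_smul, Finset.sum_const_zero, add_zero] at hr
      exact (smul_eq_zero.1 hr).resolve_right hl
    | succ j => exact h2 j
  have hsup : chainIdeal (Ideal.span {linForm (w 0)}) f' N =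
      chainIdeal ⊥ f' N ⊔ Ideal.span {linForm l} := by
    rw [hw0, ← chainIdeal_sup, bot_sup_eq]
  have hch : IsNzdChain (Ideal.span {linForm (w 0)}) f' N := by
    have := hf' 1 le_rfl
    rw [chainIdeal_succ, chainIdeal_zero, bot_sup_eq] at this
    rw [hw0]
    exact this
  refine le_trans (Nat.mul_le_mul_left 2 (Submodule.finrank_mono fun a ha => ?_))
    (finrank_linRel_chainIdeal_le hwi hch (fun i hi => hf'h i (by omega)) (by omega))
  rw [mem_linRel] at ha ⊢
  rw [hsup]
  simp only [hwu]
  exact hsq.link_sum_mem (fun j _ => hu j) ha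

/-- If a linear form annihilates all but the last of the quadrics `g_j` modulo a complete
intersection of quadrics, then the `g_j` have at most `δ (δ + 3) / 2` linear relations. -/
theorem finrank_linRel_le_of_infinite {f : ℕ → MvPolynomial (Fin n) K}
    (hf : IsNzdChain ⊥ f n) (hfh : ∀ i < n, (f i).IsHomogeneous 2) {t : ℕ} (ht1 : 1 ≤ t)
    (ht : t + 1 ≤ n) {g : Fin (t + 1) → MvPolynomial (Fin n) K} (hg : ∀ j, (g j).IsHomogeneous 2)
    (hgi : LinearIndependent K fun j => Ideal.Quotient.mkₐ K (chainIdeal ⊥ f n) (g j))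
    {l : Fin n → K} (hlg : ∀ j : Fin t, linForm l * g j.castSucc ∈ chainIdeal ⊥ f n)
    (hlast : linForm l * g (Fin.last t) ∉ chainIdeal ⊥ f n) :
    2 * Module.finrank K (linRel (chainIdeal ⊥ f n) g) ≤ (t + 1) * (t + 4) := by
  have hl : l ≠ 0 := by
    rintro rfl
    exact hlast (by rw [map_zero, zero_mul]; exact zero_mem _)
  let W : Submodule K (Fin n → K) := ((chainIdeal ⊥ f n).restrictScalars K).comap
    (LinearMap.mulRight K (linForm l * g (Fin.last t)) ∘ₗ linForm)
  have hc : (linForm l * g (Fin.last t)).IsHomogeneous 3 :=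
    (linForm_isHomogeneous l).mul (hg _)
  have h3 := finrank_linearAnn_cubic_le hf hfh hc hlast (W := W) fun v hv => hv
  have h1 := finrank_linRel_succ_le (J := chainIdeal ⊥ f n) (g := g) (W := W) (by
    intro a ha
    rw [mem_linRel, Fin.sum_univ_castSucc] at ha
    change linForm (a (Fin.last t)) * (linForm l * g (Fin.last t)) ∈ chainIdeal ⊥ f n
    -- Multiplication by l kills all terms but the last, so the last coefficient annihilates the
    -- cubic.
    have h4 := Ideal.mul_mem_left _ (linForm l) ha
    rw [mul_add, Finset.mul_sum] at h4
    have h5 : ∑ j : Fin t, linForm l * (linForm (a j.castSucc) * g j.castSucc) ∈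
        chainIdeal ⊥ f n := Ideal.sum_mem _ fun j _ => by
      rw [mul_left_comm]; exact Ideal.mul_mem_left _ _ (hlg j)
    have h6 := sub_mem h4 h5
    rwa [add_sub_cancel_left, mul_left_comm] at h6)
  have h2 := finrank_linRel_of_annihilated_le hf hfh ht (g := fun j => g j.castSucc)
    (fun j => hg _) (hgi.comp Fin.castSucc (Fin.castSucc_injective _)) hl hlg
  -- The difference (t + 1)(t + 4) - t(t + 3) = 2(t + 2) is at least 6 = 2·3, since t ≥ 1.
  nlinarith

end Infinite

/-! ### Extension of the base field -/

section BaseChange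

variable {K L : Type*} [Field K] [Field L] [Algebra K L] {n : ℕ}

/-- Apply a `K`-linear functional `L → K` to the coefficients of a polynomial. -/
noncomputable def coeffMap (π : L →ₗ[K] K) (p : MvPolynomial (Fin n) L) : MvPolynomial (Fin n) K :=
  ∑ u ∈ p.support, monomial u (π (coeff u p))

theorem coeff_coeffMap (π : L →ₗ[K] K) (p : MvPolynomial (Fin n) L) (u : Fin n →₀ ℕ) :
    coeff u (coeffMap π p) = π (coeff u p) := by
  classical
  rw [coeffMap, coeff_sum]
  simp only [coeff_monomial, Finset.sum_ite_eq', mem_support_iff]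
  split_ifs with h
  · rfl
  · rw [not_not.1 h, map_zero]

theorem coeffMap_sum (π : L →ₗ[K] K) {ι : Type*} (s : Finset ι) (p : ι → MvPolynomial (Fin n) L) :
    coeffMap π (∑ i ∈ s, p i) = ∑ i ∈ s, coeffMap π (p i) := by
  ext u
  simp only [coeff_coeffMap, coeff_sum, map_sum]

theorem coeffMap_mul_map (π : L →ₗ[K] K) (p : MvPolynomial (Fin n) L) (q : MvPolynomial (Fin n) K) :
    coeffMap π (p * map (algebraMap K L) q) = coeffMap π p * q := by
  ext u
  simp only [coeff_coeffMap, coeff_mul, map_sum, coeff_map]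
  refine Finset.sum_congr rfl fun x _ => ?_
  rw [mul_comm, ← Algebra.smul_def, map_smul, smul_eq_mul, mul_comm]

theorem coeffMap_smul_map (π : L →ₗ[K] K) (a : L) (q : MvPolynomial (Fin n) K) :
    coeffMap π (a • map (algebraMap K L) q) = π a • q := by
  ext u
  simp only [coeff_coeffMap, coeff_smul, coeff_map, smul_eq_mul]
  rw [mul_comm, ← Algebra.smul_def, map_smul, smul_eq_mul, mul_comm]

theorem eq_zero_of_forall_functional {a : L} (h : ∀ π : L →ₗ[K] K, π a = 0) : a = 0 :=
  (Module.forall_dual_apply_eq_zero_iff K a).1 h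

/-- Membership in the extended ideal is tested by K-linear functionals on L: in a K-basis b of L, p
= ∑ b_i p_i, where p_i arises by applying the i-th coordinate functional to the coefficients. This
makes descent elementary. -/
theorem mem_map_iff_coeffMap {J : Ideal (MvPolynomial (Fin n) K)} {p : MvPolynomial (Fin n) L} :
    p ∈ J.map (map (algebraMap K L)) ↔ ∀ π : L →ₗ[K] K, coeffMap π p ∈ J := by
  classical
  constructor
  · intro hp π
    obtain ⟨m, c, x, rfl⟩ := Submodule.mem_span_set'.1 hp
    rw [coeffMap_sum]
    refine Ideal.sum_mem _ fun i _ => ?_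
    obtain ⟨q, hq, hqx⟩ := (x i).2
    rw [smul_eq_mul, ← hqx]
    have := coeffMap_mul_map π (c i) q
    rw [show (map (algebraMap K L) : MvPolynomial (Fin n) K →+* _) q = map (algebraMap K L) q
      from rfl, this]
    exact Ideal.mul_mem_left _ _ hq
  · intro h
    let b := Module.Basis.ofVectorSpace K L
    let A := p.support.biUnion fun u => (b.repr (coeff u p)).support
    have hp : p = ∑ i ∈ A, C (b i) * map (algebraMap K L) (coeffMap (b.coord i) p) := by
      ext u
      simp only [coeff_sum, coeff_C_mul, coeff_map, coeff_coeffMap]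
      by_cases hu : u ∈ p.support
      · conv_lhs => rw [← b.linearCombination_repr (coeff u p), Finsupp.linearCombination_apply,
          Finsupp.sum_of_support_subset (s := A) _
            (Finset.subset_biUnion_of_mem (fun u => (b.repr (coeff u p)).support) hu) _ (by simp)]
        refine Finset.sum_congr rfl fun i _ => ?_
        rw [Algebra.smul_def, mul_comm, Module.Basis.coord_apply]
      · rw [notMem_support_iff.1 hu]
        simp
    rw [hp]
    exact Ideal.sum_mem _ fun i _ => Ideal.mul_mem_left _ _ (Ideal.mem_map_of_mem _ (h _))

theorem map_mem_map_iff {J : Ideal (MvPolynomial (Fin n) K)} {p : MvPolynomial (Fin n) K} :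
    map (algebraMap K L) p ∈ J.map (map (algebraMap K L)) ↔ p ∈ J := by
  refine ⟨fun h => ?_, fun h => Ideal.mem_map_of_mem _ h⟩
  obtain ⟨π, hπ⟩ : ∃ π : L →ₗ[K] K, π 1 ≠ 0 := by
    by_contra! hcon
    exact one_ne_zero (eq_zero_of_forall_functional hcon)
  have h1 := mem_map_iff_coeffMap.1 h π
  rw [← one_smul L (map (algebraMap K L) p), coeffMap_smul_map, smul_eq_C_mul] at h1
  have h2 := Ideal.mul_mem_left _ (C (π 1)⁻¹) h1
  rwa [← mul_assoc, ← C_mul, inv_mul_cancel₀ hπ, C_1, one_mul] at h2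

theorem NzdMod.map {s : Ideal (MvPolynomial (Fin n) K)} {a : MvPolynomial (Fin n) K}
    (h : NzdMod s a) :
    NzdMod (s.map (MvPolynomial.map (algebraMap K L))) (MvPolynomial.map (algebraMap K L) a) := by
  intro x hx
  rw [mem_map_iff_coeffMap] at hx ⊢
  intro π
  refine h _ ?_
  have := hx π
  rwa [mul_comm, coeffMap_mul_map, mul_comm] at this

theorem map_chainIdeal {R S : Type*} [CommRing R] [CommRing S] (φ : R →+* S) (s : Ideal R)
    (t : ℕ → R) (k : ℕ) :
    (chainIdeal s t k).map φ = chainIdeal (s.map φ) (fun i => φ (t i)) k := by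
  induction k with
  | zero => rfl
  | succ k ih =>
    rw [chainIdeal_succ, chainIdeal_succ, Ideal.map_sup, ih, Ideal.map_span, Set.image_singleton]

theorem map_linForm (v : Fin n → K) :
    map (algebraMap K L) (linForm v) = linForm fun i => algebraMap K L (v i) := by
  simp only [linForm_apply, smul_eq_C_mul, map_sum, map_mul, map_C, map_X]

theorem linearIndependent_mkₐ_map {J : Ideal (MvPolynomial (Fin n) K)} {ι : Type*} [Finite ι]
    {g : ι → MvPolynomial (Fin n) K}
    (hg : LinearIndependent K fun j => Ideal.Quotient.mkₐ K J (g j)) :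
    LinearIndependent L fun j => Ideal.Quotient.mkₐ L (J.map (map (algebraMap K L)))
      (map (algebraMap K L) (g j)) := by
  have := Fintype.ofFinite ι
  rw [Fintype.linearIndependent_iff] at hg ⊢
  intro r hr j
  refine eq_zero_of_forall_functional (K := K) fun π => hg (fun j => π (r j)) ?_ j
  simp only [← map_smul, ← map_sum] at hr ⊢
  have h := mem_map_iff_coeffMap.1 (Ideal.Quotient.eq_zero_iff_mem.1 hr) π
  rw [coeffMap_sum] at h
  simp only [coeffMap_smul_map] at h
  exact Ideal.Quotient.eq_zero_iff_mem.2 h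

/-- A K-basis of the relations stays independent over L, as functionals L → K send an L-dependence
to K-dependences. -/
theorem finrank_linRel_le_map {J : Ideal (MvPolynomial (Fin n) K)} {t : ℕ}
    {g : Fin t → MvPolynomial (Fin n) K} :
    Module.finrank K (linRel J g) ≤ Module.finrank L
      (linRel (J.map (map (algebraMap K L))) fun j => map (algebraMap K L) (g j)) := by
  let b := Module.finBasis K (linRel J g)
  let z : Fin (Module.finrank K (linRel J g)) →
      linRel (J.map (map (algebraMap K L))) fun j => map (algebraMap K L) (g j) := fun i =>
    ⟨fun j k => algebraMap K L ((b i).1 j k), by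
      rw [mem_linRel]
      simp only [← map_linForm, ← map_mul, ← map_sum]
      exact Ideal.mem_map_of_mem _ (mem_linRel.1 (b i).2)⟩
  have hz : LinearIndependent L z := by
    rw [Fintype.linearIndependent_iff]
    intro r hr i
    refine eq_zero_of_forall_functional (K := K) fun π => ?_
    refine Fintype.linearIndependent_iff.1 b.linearIndependent (fun i => π (r i)) ?_ i
    ext j k
    have h := congrArg (fun x => π (x.1 j k)) hr
    simp only [z, Submodule.coe_sum, Submodule.coe_smul, Finset.sum_apply, Pi.smul_apply,
      smul_eq_mul, map_sum, Submodule.coe_zero, Pi.zero_apply, map_zero] at h ⊢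
    rw [← h]
    refine Finset.sum_congr rfl fun i _ => ?_
    rw [mul_comm (r i), ← Algebra.smul_def, map_smul, smul_eq_mul, mul_comm]
  simpa using hz.fintype_card_le_finrank

/-- If a linear form annihilates all but the last of the quadrics `g_j` modulo a complete
intersection of quadrics, then the `g_j` have at most `δ (δ + 3) / 2` linear relations. -/
theorem finrank_linRel_le {f : ℕ → MvPolynomial (Fin n) K}
    (hf : IsNzdChain ⊥ f n) (hfh : ∀ i < n, (f i).IsHomogeneous 2) {t : ℕ} (ht1 : 1 ≤ t)
    (ht : t + 1 ≤ n) {g : Fin (t + 1) → MvPolynomial (Fin n) K} (hg : ∀ j, (g j).IsHomogeneous 2)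
    (hgi : LinearIndependent K fun j => Ideal.Quotient.mkₐ K (chainIdeal ⊥ f n) (g j))
    {l : Fin n → K} (hlg : ∀ j : Fin t, linForm l * g j.castSucc ∈ chainIdeal ⊥ f n)
    (hlast : linForm l * g (Fin.last t) ∉ chainIdeal ⊥ f n) :
    2 * Module.finrank K (linRel (chainIdeal ⊥ f n) g) ≤ (t + 1) * (t + 4) := by
  -- Any infinite extension field would serve.
  let L := AlgebraicClosure K
  have hmap : ∀ k, (chainIdeal ⊥ f k).map (map (algebraMap K L)) =
      chainIdeal ⊥ (fun i => map (algebraMap K L) (f i)) k := fun k => by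
    rw [map_chainIdeal, Ideal.map_bot]
  refine (Nat.mul_le_mul_left 2 (finrank_linRel_le_map (L := L))).trans ?_
  rw [hmap]
  refine finrank_linRel_le_of_infinite (l := fun i => algebraMap K L (l i)) (fun i hi => ?_)
    (fun i hi => (hfh i hi).map _) ht1 ht (fun j => (hg j).map _) ?_ (fun j => ?_) ?_
  · rw [← hmap]
    exact (hf i hi).map
  · rw [← hmap]
    exact linearIndependent_mkₐ_map hgi
  · rw [← hmap, ← map_linForm, ← map_mul, map_mem_map_iff]
    exact hlg j
  · rw [← hmap, ← map_linForm, ← map_mul, map_mem_map_iff]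
    exact hlast

end BaseChange

/-! ### From relations to the Hilbert function of I -/

section Hilbert

variable {K : Type*} [Field K] {n : ℕ}

/-- By regularity the last coefficient lies in the ideal of the preceding quadrics; being linear, it
is zero. -/
theorem linComb_eq_zero {f : ℕ → MvPolynomial (Fin n) K} {m : ℕ} (hf : IsNzdChain ⊥ f m)
    (hfh : ∀ i < m, (f i).IsHomogeneous 2) {a : Fin m → Fin n → K}
    (ha : linComb (fun i : Fin m => f i) a = 0) : a = 0 := by
  induction m with
  | zero => exact Subsingleton.elim _ _
  | succ m ih =>
    rw [linComb_apply, Fin.sum_univ_castSucc] at ha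
    have h1 : linForm (a (Fin.last m)) ∈ chainIdeal ⊥ f m := by
      refine hf m (by omega) _ ?_
      have h0 := eq_neg_of_add_eq_zero_right ha
      rw [Fin.val_last] at h0
      rw [mul_comm, h0]
      exact neg_mem (Ideal.sum_mem _ fun j _ => Ideal.mul_mem_left _ _ (mem_chainIdeal _ _ j.2))
    have h2 := homogeneousComponent_eq_zero_of_mem_chainIdeal (fun i hi => hfh i (by omega))
      one_lt_two h1
    rw [homogeneousComponent_of_mem (linForm_isHomogeneous _), if_pos rfl] at h2
    have h3 : a (Fin.last m) = 0 := linForm_injective (by rw [h2, map_zero])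
    rw [h2, zero_mul, add_zero] at ha
    have h4 := ih (hf.mono (by omega)) (fun i hi => hfh i (by omega))
      (a := fun j => a j.castSucc) (by rw [linComb_apply]; exact ha)
    funext j
    induction j using Fin.lastCases with
    | last => exact h3
    | cast j => exact congrFun h4 j

instance finiteDimensional_homogeneousSubmodule (d : ℕ) :
    FiniteDimensional K (homogeneousSubmodule (Fin n) K d) :=
  Module.Finite.iff_fg.2 (homogeneousSubmodule_fg (Fin n) K d)

/-- The family is padded by 0 to an ℕ-indexed sequence; only its first n terms matter. -/
theorem chainIdeal_bot_extend (f : Fin n → MvPolynomial (Fin n) K) :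
    chainIdeal ⊥ (fun i => if h : i < n then f ⟨i, h⟩ else 0) n = Ideal.span (Set.range f) := by
  rw [chainIdeal_eq, bot_sup_eq]
  simp

theorem IsRegular.isNzdChain {f : Fin n → MvPolynomial (Fin n) K}
    (hf : RingTheory.Sequence.IsRegular (MvPolynomial (Fin n) K) (List.ofFn f)) :
    IsNzdChain ⊥ (fun i => if h : i < n then f ⟨i, h⟩ else 0) n := by
  intro i hi x hx
  have h1 := hf.regular_mod_prev i (by simpa using hi)
  have h2 : (Ideal.ofList ((List.ofFn f).take i) • (⊤ : Submodule (MvPolynomial (Fin n) K)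
      (MvPolynomial (Fin n) K))) = chainIdeal ⊥ (fun i => if h : i < n then f ⟨i, h⟩ else 0) i := by
    rw [smul_eq_mul, Ideal.mul_top, chainIdeal_eq, bot_sup_eq, Ideal.ofList]
    congr 1
    ext y
    simp only [Set.mem_ofPred_eq, Set.mem_range, List.mem_take_iff_getElem, List.length_ofFn,
      List.getElem_ofFn]
    constructor
    · rintro ⟨j, hj, rfl⟩
      exact ⟨⟨j, (lt_min_iff.1 hj).1⟩, dif_pos _⟩
    · rintro ⟨j, rfl⟩
      exact ⟨j, by omega, by rw [dif_pos (j.2.trans hi)]⟩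
  rw [h2] at h1
  beta_reduce at hx
  rw [dif_pos hi] at hx
  rw [List.getElem_ofFn] at h1
  exact mem_of_isSMulRegular_quotient_of_smul_mem h1 hx

variable {δ : ℕ} {f : Fin n → MvPolynomial (Fin n) K} {g : Fin δ → MvPolynomial (Fin n) K}
  {I : Ideal (MvPolynomial (Fin n) K)}

theorem EGH.IsDefectQuadratic.hilb_two (hI : EGH.IsDefectQuadratic f g I) :
    EGH.hilb I 2 = n + δ := by
  have hh : ∀ i, (Sum.elim f g i).IsHomogeneous 2 := by
    rintro (i | j)
    · exact hI.f_quadratic i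
    · exact hI.g_quadratic j
  have h1 : I = Ideal.span (Set.range (Sum.elim f g)) := by
    rw [hI.eq_sup, Set.Sum.elim_range, Ideal.span_union]
  have h2 : EGH.component I 2 = Submodule.span K (Set.range (Sum.elim f g)) := by
    apply le_antisymm
    · rintro p ⟨hp, hp2⟩
      rw [h1] at hp
      obtain ⟨c, hc, rfl⟩ := exists_isHomogeneous_of_mem_span_range (d := 0) (e := 2) hh
        (by simpa using hp2) hp
      refine Submodule.sum_mem _ fun i _ => ?_
      obtain ⟨a, ha⟩ := exists_C_of_isHomogeneous_zero (hc i)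
      rw [ha, C_mul']
      exact Submodule.smul_mem _ _ (Submodule.subset_span ⟨i, rfl⟩)
    · rw [Submodule.span_le]
      rintro _ ⟨i, rfl⟩
      refine ⟨?_, hh i⟩
      rw [h1]
      exact Ideal.subset_span ⟨i, rfl⟩
  rw [EGH.hilb, h2, finrank_span_eq_card hI.linearIndependent]
  simp

theorem EGH.IsDefectQuadratic.le_hilb_three (hI : EGH.IsDefectQuadratic f g I) (hδ : 2 ≤ δ)
    (hδn : δ + 1 ≤ n) {k : Fin δ} (hk : (k : ℕ) + 1 = δ)
    (hann : (EGH.linearAnn (Ideal.span (Set.range f)) {p | ∃ j : Fin δ, (j : ℕ) + 1 < δ ∧ p = g j} \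
      EGH.linearAnn (Ideal.span (Set.range f)) {g k}).Nonempty) :
    2 * (n * (n + δ)) ≤ 2 * EGH.hilb I 3 + δ * (δ + 3) := by
  obtain ⟨_, ⟨⟨l, hl, rfl⟩, hkill⟩, hnot⟩ := hann
  obtain ⟨v, rfl⟩ := exists_linForm_eq hl
  obtain ⟨t, rfl⟩ : ∃ t, δ = t + 1 := ⟨δ - 1, by omega⟩
  obtain rfl : k = Fin.last t := Fin.ext (by simpa using hk)
  have hch := IsRegular.isNzdChain hI.regular
  have hF := chainIdeal_bot_extend f
  set F : ℕ → MvPolynomial (Fin n) K := fun i => if h : i < n then f ⟨i, h⟩ else 0 with hFdef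
  have hFf : (fun i : Fin n => F i) = f := by
    funext i
    simp [F]
  have hFh : ∀ i < n, (F i).IsHomogeneous 2 := fun i hi => by
    simpa [F, hi] using hI.f_quadratic ⟨i, hi⟩
  have hgi : LinearIndependent K fun j => Ideal.Quotient.mkₐ K (chainIdeal ⊥ F n) (g j) := by
    rw [Fintype.linearIndependent_iff]
    intro r hr
    simp only [← map_smul, ← map_sum] at hr
    have h1 := Ideal.Quotient.eq_zero_iff_mem.1 hr
    rw [hF] at h1
    obtain ⟨c, hc, hcs⟩ := exists_isHomogeneous_of_mem_span_range (d := 0) (e := 2) hI.f_quadratic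
      (by
        rw [zero_add]
        exact Submodule.sum_mem (homogeneousSubmodule (Fin n) K 2) fun j _ =>
          Submodule.smul_mem _ _ (hI.g_quadratic j)) h1
    choose a ha using fun i => exists_C_of_isHomogeneous_zero (hc i)
    have h2 := Fintype.linearIndependent_iff.1 hI.linearIndependent (Sum.elim (fun i => - a i) r) (by
      rw [Fintype.sum_sum_type]
      simp only [Sum.elim_inl, Sum.elim_inr, ← hcs, ha, C_mul', neg_smul, Finset.sum_neg_distrib]
      exact neg_add_cancel _)
    exact fun j => h2 (Sum.inr j)
  have hmk : ∀ x y, Ideal.Quotient.mk (Ideal.span (Set.range f)) x *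
      Ideal.Quotient.mk (Ideal.span (Set.range f)) y = 0 ↔ x * y ∈ Ideal.span (Set.range f) := by
    intro x y
    rw [← map_mul, Ideal.Quotient.eq_zero_iff_mem]
  have hrel := finrank_linRel_le hch hFh (by omega) (by omega) hI.g_quadratic hgi (l := v)
    (fun j => by
      rw [hF, ← hmk]
      exact hkill _ ⟨j.castSucc, by simp, rfl⟩)
    (fun hcon => by
      rw [hF, ← hmk] at hcon
      refine hnot ⟨⟨_, hl, rfl⟩, ?_⟩
      rintro _ rfl
      exact hcon)
  let Φ : (Fin n → Fin n → K) × (Fin (t + 1) → Fin n → K) →ₗ[K] MvPolynomial (Fin n) K :=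
    (linComb f).coprod (linComb g)
  -- The g-coefficients determine an element of the kernel, since the f_i have no linear syzygies.
  have hker : Module.finrank K (LinearMap.ker Φ) ≤
      Module.finrank K (linRel (chainIdeal ⊥ F n) g) := by
    let ψ : LinearMap.ker Φ →ₗ[K] linRel (chainIdeal ⊥ F n) g :=
      (LinearMap.snd K _ _ ∘ₗ (LinearMap.ker Φ).subtype).codRestrict _ fun x => by
        have hx : linComb f x.1.1 + linComb g x.1.2 = 0 := x.2
        change linComb g x.1.2 ∈ chainIdeal ⊥ F n
        rw [eq_neg_of_add_eq_zero_right hx, linComb_apply, hF]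
        exact neg_mem (Ideal.sum_mem _ fun i _ =>
          Ideal.mul_mem_left _ _ (Ideal.subset_span ⟨i, rfl⟩))
    refine LinearMap.finrank_le_finrank_of_injective (f := ψ) ?_
    rw [injective_iff_map_eq_zero]
    intro x hx
    have h0 : x.1.2 = 0 := congrArg Subtype.val hx
    have hx' : linComb f x.1.1 + linComb g x.1.2 = 0 := x.2
    rw [h0, map_zero, add_zero, ← hFf] at hx'
    exact Subtype.ext (Prod.ext (linComb_eq_zero hch hFh hx') h0)
  have hrange : LinearMap.range Φ ≤ EGH.component I 3 := by
    rintro _ ⟨⟨b, a⟩, rfl⟩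
    change linComb f b + linComb g a ∈ _
    rw [linComb_apply, linComb_apply]
    refine add_mem (Submodule.sum_mem _ fun i _ => ⟨?_, ?_⟩) (Submodule.sum_mem _ fun i _ => ⟨?_, ?_⟩)
    · rw [hI.eq_sup]
      exact Ideal.mul_mem_left _ _ (Ideal.mem_sup_left (Ideal.subset_span (Set.mem_range_self i)))
    · exact (linForm_isHomogeneous _).mul (hI.f_quadratic i)
    · rw [hI.eq_sup]
      exact Ideal.mul_mem_left _ _ (Ideal.mem_sup_right (Ideal.subset_span (Set.mem_range_self i)))
    · exact (linForm_isHomogeneous _).mul (hI.g_quadratic i)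
  have : FiniteDimensional K (EGH.component I 3) := Submodule.finiteDimensional_inf_right _ _
  have h1 := LinearMap.finrank_range_add_finrank_ker Φ
  have h2 := Submodule.finrank_mono hrange
  have h3 : Module.finrank K ((Fin n → Fin n → K) × (Fin (t + 1) → Fin n → K)) =
      n * (n + (t + 1)) := by
    simp [Module.finrank_pi_fintype]
    ring
  rw [EGH.hilb]
  nlinarith

end Hilbert

/-! ### Up-closed sets with a prescribed count -/

section UpClosed

/-- Adjoining a largest missing element keeps the set up-closed and raises the count by at most one,
so no value is skipped; a set of maximal size with count at most t attains t. -/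
theorem exists_upClosed_card_eq {α β : Type*} [DecidableEq α] [LinearOrder β] {e : α → β}
    {D B : Finset α} (hBD : B ⊆ D)
    (hB : ∀ u ∈ B, ∀ v ∈ D, e u < e v → v ∈ B) (p : α → Prop) [DecidablePred p] {t : ℕ}
    (h1 : (D.filter fun u => u ∈ B ∨ p u).card ≤ t) (h2 : t ≤ D.card) :
    ∃ S : Finset α, B ⊆ S ∧ S ⊆ D ∧ (∀ u ∈ S, ∀ v ∈ D, e u < e v → v ∈ S) ∧
      (D.filter fun u => u ∈ S ∨ p u).card = t := by
  classical
  let 𝒮 := D.powerset.filter fun S => B ⊆ S ∧ (∀ u ∈ S, ∀ v ∈ D, e u < e v → v ∈ S) ∧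
    (D.filter fun u => u ∈ S ∨ p u).card ≤ t
  obtain ⟨S, hS, hmax⟩ := 𝒮.exists_max_image Finset.card
    ⟨B, Finset.mem_filter.2 ⟨Finset.mem_powerset.2 hBD, subset_rfl, hB, h1⟩⟩
  obtain ⟨hSD, hBS, hSup, hSt⟩ := Finset.mem_filter.1 hS
  rw [Finset.mem_powerset] at hSD
  refine ⟨S, hBS, hSD, hSup, hSt.antisymm (not_lt.1 fun hlt => ?_)⟩
  have hne : (D \ S).Nonempty := by
    rw [Finset.sdiff_nonempty]
    intro hDS
    rw [Finset.filter_true_of_mem fun u hu => Or.inl (hDS hu)] at hlt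
    omega
  obtain ⟨m, hm, hmm⟩ := (D \ S).exists_max_image e hne
  rw [Finset.mem_sdiff] at hm
  have hmem : insert m S ∈ 𝒮 := by
    refine Finset.mem_filter.2 ⟨Finset.mem_powerset.2 (Finset.insert_subset hm.1 hSD),
      hBS.trans (Finset.subset_insert _ _), fun u hu v hv huv => ?_, ?_⟩
    · by_contra hcon
      rw [Finset.mem_insert, not_or] at hcon
      rcases Finset.mem_insert.1 hu with rfl | hu
      · exact absurd (hmm v (Finset.mem_sdiff.2 ⟨hv, hcon.2⟩)) (not_le.2 huv)
      · exact hcon.2 (hSup u hu v hv huv)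
    · have hsub : (D.filter fun u => u ∈ insert m S ∨ p u) ⊆
          insert m (D.filter fun u => u ∈ S ∨ p u) := by
        intro u
        simp only [Finset.mem_filter, Finset.mem_insert]
        tauto
      have := (Finset.card_le_card hsub).trans (Finset.card_insert_le _ _)
      omega
  have := hmax _ hmem
  rw [Finset.card_insert_of_notMem hm.2] at this
  omega

end UpClosed

/-! ### Hilbert functions of monomial ideals -/

section Monomial

variable {K : Type*} [Field K] {n : ℕ}

theorem component_span_monomial (M : Set (Fin n →₀ ℕ)) (d : ℕ) :
    EGH.component (Ideal.span ((fun u => monomial u (1 : K)) '' M)) d =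
      Submodule.span K ((fun u => monomial u (1 : K)) '' {u | (∃ m ∈ M, m ≤ u) ∧ u.degree = d}) := by
  apply le_antisymm
  · rintro p ⟨hp, hpd⟩
    have hp' := mem_ideal_span_monomial_image.1 hp
    rw [p.as_sum]
    refine Submodule.sum_mem _ fun u hu => ?_
    rw [← mul_one (coeff u p), ← smul_eq_mul, ← smul_monomial]
    refine Submodule.smul_mem _ _ (Submodule.subset_span ⟨u, ⟨hp' u hu, ?_⟩, rfl⟩)
    have hpd' : p.IsHomogeneous d := hpd
    have := hpd' (mem_support_iff.1 hu)
    rwa [Finsupp.degree_eq_weight_one]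
  · rw [Submodule.span_le]
    rintro _ ⟨u, ⟨hm, hd⟩, rfl⟩
    refine ⟨mem_ideal_span_monomial_image.2 fun v hv => ?_, isHomogeneous_monomial _ hd⟩
    rw [Finset.mem_singleton.1 (support_monomial_subset hv)]
    exact hm

theorem hilb_span_monomial (M : Set (Fin n →₀ ℕ)) (d : ℕ) :
    EGH.hilb (Ideal.span ((fun u => monomial u (1 : K)) '' M)) d =
      {u : Fin n →₀ ℕ | (∃ m ∈ M, m ≤ u) ∧ u.degree = d}.ncard := by
  rw [EGH.hilb, component_span_monomial]
  set A := {u : Fin n →₀ ℕ | (∃ m ∈ M, m ≤ u) ∧ u.degree = d} with hA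
  have hfin : A.Finite := (Finsupp.finite_of_degree_eq d).subset fun u hu => hu.2
  have := hfin.fintype
  have hli : LinearIndependent K fun u : A => monomial (u : Fin n →₀ ℕ) (1 : K) := by
    have h := (basisMonomials (Fin n) K).linearIndependent
    rw [coe_basisMonomials] at h
    exact h.comp Subtype.val Subtype.val_injective
  rw [Set.image_eq_range, finrank_span_eq_card hli, Set.ncard_eq_toFinset_card', Set.toFinset_card]

theorem span_X_sq_sup_span_monomial (M : Set (Fin n →₀ ℕ)) :
    Ideal.span (Set.range fun i : Fin n => (X i : MvPolynomial (Fin n) K) ^ 2) ⊔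
      Ideal.span ((fun u => monomial u (1 : K)) '' M) =
    Ideal.span ((fun u => monomial u (1 : K)) ''
      ((Set.range fun i : Fin n => Finsupp.single i 2) ∪ M)) := by
  rw [Set.image_union, Ideal.span_union, ← Set.range_comp]
  congr 3
  funext i
  exact X_pow_eq_monomial

/-- The monomial `u` is divisible by some `x_1 x_j` with `j ≤ δ + 1`. -/
abbrev DvdByLexSegment (δ : ℕ) (u : Fin n →₀ ℕ) : Prop :=
  ∃ i j : Fin n, (i : ℕ) = 0 ∧ (j : ℕ) ≤ δ ∧ Finsupp.single i 1 + Finsupp.single j 1 ≤ u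

/-- The exponents divisible by a square of a variable or by some `x_1 x_j` with `j ≤ δ + 1`. -/
def lppExponents (n δ d : ℕ) : Set (Fin n →₀ ℕ) :=
  {u | ((∃ i, 2 ≤ u i) ∨ DvdByLexSegment δ u) ∧ u.degree = d}

theorem single_two_le_iff {i : Fin n} {u : Fin n →₀ ℕ} : Finsupp.single i 2 ≤ u ↔ 2 ≤ u i := by
  rw [Finsupp.single_le_iff]

theorem single_add_single_le_iff {i j : Fin n} (hij : i ≠ j) {u : Fin n →₀ ℕ} :
    Finsupp.single i 1 + Finsupp.single j 1 ≤ u ↔ 1 ≤ u i ∧ 1 ≤ u j := by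
  constructor
  · intro h
    have h1 := h i
    have h2 := h j
    simp [hij, hij.symm] at h1 h2
    exact ⟨h1, h2⟩
  · rintro ⟨h1, h2⟩ k
    rw [Finsupp.add_apply, Finsupp.single_apply, Finsupp.single_apply]
    split_ifs with h3 h4 h4
    · exact absurd (h3.trans h4.symm) hij
    · subst h3; simpa using h1
    · subst h4; simpa using h2
    · simp

theorem hilb_lppIdeal (n δ d : ℕ) :
    EGH.hilb (EGH.lppIdeal K n δ) d = (lppExponents n δ d).ncard := by
  have h1 : EGH.lppIdeal K n δ = Ideal.span ((fun u => monomial u (1 : K)) ''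
      ((Set.range fun i : Fin n => Finsupp.single i 2) ∪
        {u | ∃ i j : Fin n, (i : ℕ) = 0 ∧ 1 ≤ (j : ℕ) ∧ (j : ℕ) ≤ δ ∧
          u = Finsupp.single i 1 + Finsupp.single j 1})) := by
    rw [← span_X_sq_sup_span_monomial, EGH.lppIdeal]
    congr 2
    ext p
    simp only [Set.mem_ofPred_eq, Set.mem_image]
    constructor
    · rintro ⟨i, j, h0, hj1, hj2, rfl⟩
      refine ⟨_, ⟨i, j, h0, hj1, hj2, rfl⟩, ?_⟩
      rw [X, X, monomial_mul, one_mul]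
    · rintro ⟨_, ⟨i, j, h0, hj1, hj2, rfl⟩, rfl⟩
      refine ⟨i, j, h0, hj1, hj2, ?_⟩
      rw [X, X, monomial_mul, one_mul]
  rw [h1, hilb_span_monomial, lppExponents]
  congr 1
  ext u
  simp only [Set.mem_ofPred_eq, and_congr_left_iff]
  intro _
  constructor
  · rintro ⟨_, ⟨i, rfl⟩ | ⟨i, j, h0, _, hj, rfl⟩, hu⟩
    · exact Or.inl ⟨i, single_two_le_iff.1 hu⟩
    · exact Or.inr ⟨i, j, h0, hj, hu⟩
  · rintro (⟨i, hi⟩ | ⟨i, j, h0, hj, hu⟩)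
    · exact ⟨_, Or.inl ⟨i, rfl⟩, single_two_le_iff.2 hi⟩
    -- `DvdByLexSegment` also admits x_1·x_1, so that it describes a lex segment; this adds nothing
    -- beyond the squares.
    · by_cases hij : i = j
      · subst hij
        refine ⟨_, Or.inl ⟨i, rfl⟩, ?_⟩
        rwa [← Finsupp.single_add] at hu
      · refine ⟨_, Or.inr ⟨i, j, h0, ?_, hj, rfl⟩, hu⟩
        by_contra hcon
        exact hij (Fin.ext (by omega))

theorem hilb_le_ncard (I : Ideal (MvPolynomial (Fin n) K)) (d : ℕ) :
    EGH.hilb I d ≤ {u : Fin n →₀ ℕ | u.degree = d}.ncard := by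
  have h1 := hilb_span_monomial (K := K) (Set.univ : Set (Fin n →₀ ℕ)) d
  have h2 : {u : Fin n →₀ ℕ | (∃ m ∈ (Set.univ : Set (Fin n →₀ ℕ)), m ≤ u) ∧ u.degree = d} =
      {u : Fin n →₀ ℕ | u.degree = d} := by
    ext u
    exact ⟨fun h => h.2, fun h => ⟨⟨u, trivial, le_rfl⟩, h⟩⟩
  rw [h2] at h1
  rw [← h1]
  have : FiniteDimensional K (EGH.component (Ideal.span ((fun u => monomial u (1 : K)) ''
    (Set.univ : Set (Fin n →₀ ℕ)))) d) := Submodule.finiteDimensional_inf_right _ _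
  refine Submodule.finrank_mono (inf_le_inf_right _ fun p _ => ?_)
  exact mem_ideal_span_monomial_image.2 fun u _ => ⟨u, trivial, le_rfl⟩

theorem exists_single_eq_of_degree_eq_one {u : Fin n →₀ ℕ} (h : u.degree = 1) :
    ∃ i, u = Finsupp.single i 1 := by
  have h1 : u ∈ Set.range fun i : Fin n => Finsupp.single i (1 : ℕ) := by
    rw [Finsupp.range_single_one]; exact h
  obtain ⟨i, hi⟩ := h1
  exact ⟨i, hi.symm⟩

theorem exists_add_single_of_le {u v : Fin n →₀ ℕ} (h : v ≤ u) (hd : u.degree = v.degree + 1) :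
    ∃ i, u = v + Finsupp.single i 1 := by
  obtain ⟨w, rfl⟩ := exists_add_of_le h
  rw [map_add] at hd
  obtain ⟨i, rfl⟩ := exists_single_eq_of_degree_eq_one (u := w) (by omega)
  exact ⟨i, rfl⟩

theorem single_two_add_single_inj {i j i' j' : Fin n}
    (h : (Finsupp.single i 2 + Finsupp.single j 1 : Fin n →₀ ℕ) =
      Finsupp.single i' 2 + Finsupp.single j' 1) : i = i' ∧ j = j' := by
  have h1 : i = i' := by
    by_contra hne
    have := DFunLike.congr_fun h i
    simp [Finsupp.single_apply, Ne.symm hne] at this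
    split_ifs at this <;> omega
  subst h1
  exact ⟨rfl, Finsupp.single_left_injective one_ne_zero (add_left_cancel h)⟩

theorem single_add_single_inj_of_lt {a b a' b' : Fin n} (hab : a < b) (hab' : a' < b')
    (h : (Finsupp.single a 1 + Finsupp.single b 1 : Fin n →₀ ℕ) =
      Finsupp.single a' 1 + Finsupp.single b' 1) : a = a' ∧ b = b' := by
  have ha := DFunLike.congr_fun h a
  have hb := DFunLike.congr_fun h b
  have ha' := DFunLike.congr_fun h a'
  simp only [Finsupp.add_apply, Finsupp.single_apply] at ha hb ha'
  split_ifs at ha hb ha' <;> omega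

theorem ncard_lppExponents_two {n δ : ℕ} (hδn : δ + 1 ≤ n) :
    (lppExponents n δ 2).ncard = n + δ := by
  let z : Fin n := ⟨0, by omega⟩
  let φ : Fin n ⊕ Fin δ → (Fin n →₀ ℕ) := Sum.elim (fun i => Finsupp.single i 2)
    fun j => Finsupp.single z 1 + Finsupp.single ⟨j + 1, by omega⟩ 1
  have hφ : Function.Injective φ := by
    rintro (i | j) (i' | j') h
    · exact congrArg _ (Finsupp.single_left_injective two_ne_zero h)
    · have := DFunLike.congr_fun h i
      simp [φ, z, Finsupp.single_apply, Fin.ext_iff] at this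
      split_ifs at this <;> omega
    · have := DFunLike.congr_fun h i'
      simp [φ, z, Finsupp.single_apply, Fin.ext_iff] at this
      split_ifs at this <;> omega
    · have h1 := Finsupp.single_left_injective one_ne_zero (add_left_cancel h)
      simp only [Fin.mk.injEq, add_left_inj] at h1
      rw [Fin.ext h1]
  have hr : lppExponents n δ 2 = Set.range φ := by
    ext u
    constructor
    · rintro ⟨⟨i, hi⟩ | ⟨i, j, h0, hj, hle⟩, hd⟩
      · obtain ⟨w, rfl⟩ := exists_add_of_le (single_two_le_iff.2 hi)
        rw [map_add, Finsupp.degree_single] at hd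
        have hw : w = 0 := (Finsupp.degree_eq_zero_iff w).1 (by omega)
        exact ⟨Sum.inl i, by simp [φ, hw]⟩
      · obtain ⟨w, rfl⟩ := exists_add_of_le hle
        rw [map_add, map_add, Finsupp.degree_single, Finsupp.degree_single] at hd
        have hw : w = 0 := (Finsupp.degree_eq_zero_iff w).1 (by omega)
        have hi : i = z := Fin.ext h0
        subst hi
        by_cases hj0 : (j : ℕ) = 0
        · refine ⟨Sum.inl z, ?_⟩
          have : j = z := Fin.ext hj0
          rw [hw, this, add_zero, ← Finsupp.single_add]
          rfl
        · refine ⟨Sum.inr ⟨j - 1, by omega⟩, ?_⟩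
          have : (⟨(j : ℕ) - 1 + 1, by omega⟩ : Fin n) = j := Fin.ext (by simp; omega)
          simp only [φ, Sum.elim_inr, this, hw, add_zero]
    · rintro ⟨i | j, rfl⟩
      · exact ⟨Or.inl ⟨i, by simp [φ]⟩, by simp [φ]⟩
      · exact ⟨Or.inr ⟨z, ⟨j + 1, by omega⟩, rfl, by simp, le_rfl⟩, by simp [φ]⟩
  rw [hr, ← Set.image_univ, Set.ncard_image_of_injective _ hφ, Set.ncard_univ]
  simp

theorem sum_fin_sub {n δ : ℕ} (hδn : δ + 1 ≤ n) :
    2 * ∑ a : Fin δ, (n - 2 - (a : ℕ)) + δ * (δ + 3) = 2 * (n * δ) := by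
  induction δ with
  | zero => simp
  | succ δ ih =>
    rw [Fin.sum_univ_castSucc]
    have := ih (by omega)
    simp only [Fin.val_castSucc, Fin.val_last]
    obtain ⟨k, rfl⟩ := Nat.exists_eq_add_of_le hδn
    rw [show δ + 1 + 1 + k - 2 - δ = k by omega]
    nlinarith

/-- There are n² monomials x_i²x_j. The others are squarefree x_1x_ax_b with a < b, where
necessarily a ≤ δ + 1; with a counted from 0 this leaves n - 2 - a choices of b. -/
theorem ncard_lppExponents_three {n δ : ℕ} (hδn : δ + 1 ≤ n) :
    2 * (lppExponents n δ 3).ncard + δ * (δ + 3) = 2 * (n * (n + δ)) := by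
  let z : Fin n := ⟨0, by omega⟩
  let φ : (Fin n × Fin n) ⊕ (Σ a : Fin δ, Fin (n - 2 - (a : ℕ))) → (Fin n →₀ ℕ) :=
    Sum.elim (fun i => Finsupp.single i.1 2 + Finsupp.single i.2 1)
      fun p => Finsupp.single z 1 + (Finsupp.single ⟨p.1 + 1, by omega⟩ 1 +
        Finsupp.single ⟨p.1 + 2 + p.2, by omega⟩ 1)
  have hφ : Function.Injective φ := by
    have hmix : ∀ i p, φ (Sum.inl i) ≠ φ (Sum.inr p) := by
      intro i p h
      have := DFunLike.congr_fun h i.1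
      simp only [φ, z, Sum.elim_inl, Sum.elim_inr, Finsupp.add_apply, Finsupp.single_apply,
        Fin.ext_iff] at this
      split_ifs at this <;> omega
    rintro (i | p) (i' | p') h
    · have := single_two_add_single_inj h
      exact congrArg _ (Prod.ext this.1 this.2)
    · exact absurd h (hmix _ _)
    · exact absurd h.symm (hmix _ _)
    · have h1 := single_add_single_inj_of_lt (Fin.mk_lt_mk.2 (by omega))
        (Fin.mk_lt_mk.2 (by omega)) (add_left_cancel h)
      simp only [Fin.mk.injEq] at h1
      obtain ⟨a, b⟩ := p
      obtain ⟨a', b'⟩ := p'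
      obtain rfl : a = a' := Fin.ext (by simpa using h1.1)
      obtain rfl : b = b' := Fin.ext (by simpa using h1.2)
      rfl
  have hr : lppExponents n δ 3 = Set.range φ := by
    ext u
    constructor
    · rintro ⟨h, hd⟩
      by_cases hsq : ∃ i, 2 ≤ u i
      · obtain ⟨i, hi⟩ := hsq
        obtain ⟨j, rfl⟩ := exists_add_single_of_le (single_two_le_iff.2 hi) (by
          rw [Finsupp.degree_single, hd])
        exact ⟨Sum.inl (i, j), rfl⟩
      · obtain ⟨i, a, h0, ha, hle⟩ := h.resolve_left hsq
        obtain rfl : i = z := Fin.ext h0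
        obtain ⟨b, rfl⟩ := exists_add_single_of_le hle (by
          rw [map_add, Finsupp.degree_single, Finsupp.degree_single, hd])
        push Not at hsq
        have hza : (a : ℕ) ≠ 0 := fun hcon => by
          obtain rfl : a = z := Fin.ext hcon
          have := hsq z
          simp at this
          omega
        have hzb : (b : ℕ) ≠ 0 := fun hcon => by
          obtain rfl : b = z := Fin.ext hcon
          have := hsq z
          simp at this
        have hab : (a : ℕ) ≠ b := fun hcon => by
          obtain rfl : a = b := Fin.ext hcon
          have := hsq a
          simp at this
        rcases lt_or_gt_of_ne hab with hlt | hlt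
        · refine ⟨Sum.inr ⟨⟨a - 1, by omega⟩, ⟨b - a - 1, by simp; omega⟩⟩, ?_⟩
          have h1 : (⟨(a : ℕ) - 1 + 1, by omega⟩ : Fin n) = a := Fin.ext (by simp; omega)
          have h2 : (⟨(a : ℕ) - 1 + 2 + (b - a - 1), by omega⟩ : Fin n) = b :=
            Fin.ext (by simp; omega)
          simp only [φ, Sum.elim_inr, h1, h2]
          rw [add_assoc]
        · refine ⟨Sum.inr ⟨⟨b - 1, by omega⟩, ⟨a - b - 1, by simp; omega⟩⟩, ?_⟩
          have h1 : (⟨(b : ℕ) - 1 + 1, by omega⟩ : Fin n) = b := Fin.ext (by simp; omega)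
          have h2 : (⟨(b : ℕ) - 1 + 2 + (a - b - 1), by omega⟩ : Fin n) = a :=
            Fin.ext (by simp; omega)
          simp only [φ, Sum.elim_inr, h1, h2]
          rw [add_assoc, add_comm (Finsupp.single b 1)]
    · rintro ⟨i | p, rfl⟩
      · exact ⟨Or.inl ⟨i.1, by simp [φ]⟩, by simp [φ]⟩
      · refine ⟨Or.inr ⟨z, ⟨p.1 + 1, by omega⟩, rfl, by simp, ?_⟩, by simp [φ]⟩
        simp only [φ, Sum.elim_inr, ← add_assoc]
        exact le_self_add
  have hcard : (lppExponents n δ 3).ncard = n * n + ∑ a : Fin δ, (n - 2 - (a : ℕ)) := by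
    rw [hr, ← Set.image_univ, Set.ncard_image_of_injective _ hφ, Set.ncard_univ]
    simp
  have := sum_fin_sub hδn
  rw [hcard]
  nlinarith

end Monomial

/-! ### Construction of the lex-plus-powers ideal -/

section LexPlusPowers

variable {K : Type*} [Field K] {n : ℕ}

theorem dvdByLexSegment_iff {δ : ℕ} (hn : 0 < n) {u : Fin n →₀ ℕ} :
    DvdByLexSegment δ u ↔ 1 ≤ u ⟨0, hn⟩ ∧
      (2 ≤ u ⟨0, hn⟩ ∨ ∃ j : Fin n, (j : ℕ) ≠ 0 ∧ (j : ℕ) ≤ δ ∧ 1 ≤ u j) := by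
  constructor
  · rintro ⟨i, j, h0, hj, hle⟩
    obtain rfl : i = ⟨0, hn⟩ := Fin.ext h0
    by_cases hj0 : (j : ℕ) = 0
    · obtain rfl : j = ⟨0, hn⟩ := Fin.ext hj0
      rw [← Finsupp.single_add, single_two_le_iff] at hle
      exact ⟨by omega, Or.inl hle⟩
    · rw [single_add_single_le_iff (fun h => hj0 (congrArg Fin.val h).symm)] at hle
      exact ⟨hle.1, Or.inr ⟨j, hj0, hj, hle.2⟩⟩
  · rintro ⟨h1, h2 | ⟨j, hj0, hj, h2⟩⟩
    · refine ⟨⟨0, hn⟩, ⟨0, hn⟩, rfl, Nat.zero_le _, ?_⟩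
      rwa [← Finsupp.single_add, single_two_le_iff]
    · refine ⟨⟨0, hn⟩, j, rfl, hj, ?_⟩
      rw [single_add_single_le_iff (fun h => hj0 (congrArg Fin.val h).symm)]
      exact ⟨h1, h2⟩

/-- At the first place where u and v differ v is larger. At x_1 this yields x_1²; later, either the
factor x_j of u comes earlier and is kept, or the differing variable replaces it with an index no
larger than j. -/
theorem DvdByLexSegment.of_toLex_lt {δ : ℕ} {u v : Fin n →₀ ℕ} (hu : DvdByLexSegment δ u)
    (huv : toLex u < toLex v) : DvdByLexSegment δ v := by
  have hn : 0 < n := by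
    obtain ⟨i, -⟩ := hu
    exact i.pos
  rw [dvdByLexSegment_iff hn] at hu ⊢
  obtain ⟨i, heq, hlt⟩ := Finsupp.Lex.lt_iff.1 huv
  change ∀ j < i, u j = v j at heq
  change u i < v i at hlt
  by_cases hi : i = ⟨0, hn⟩
  · subst hi
    exact ⟨by omega, Or.inl (by omega)⟩
  · have hi0 : (i : ℕ) ≠ 0 := fun h => hi (Fin.ext h)
    have h0 := heq ⟨0, hn⟩ (Fin.lt_def.2 (Nat.pos_of_ne_zero hi0))
    rw [← h0]
    refine ⟨hu.1, hu.2.imp_right ?_⟩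
    rintro ⟨j, hj0, hj, hju⟩
    rcases lt_or_ge j i with hji | hij
    · exact ⟨j, hj0, hj, by rw [← heq j hji]; exact hju⟩
    · exact ⟨i, hi0, (Fin.le_def.1 hij).trans hj, by omega⟩

theorem DvdByLexSegment.mono {δ : ℕ} {u v : Fin n →₀ ℕ} (hu : DvdByLexSegment δ u) (huv : u ≤ v) :
    DvdByLexSegment δ v := by
  obtain ⟨i, j, h0, hj, h⟩ := hu
  exact ⟨i, j, h0, hj, h.trans huv⟩

theorem exists_mem_le_iff {M : Set (Fin n →₀ ℕ)} (hM : IsUpperSet M) {u : Fin n →₀ ℕ} :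
    (∃ m ∈ M, m ≤ u) ↔ u ∈ M :=
  ⟨fun ⟨_, hm, hmu⟩ => hM hmu hm, fun hu => ⟨u, hu, le_rfl⟩⟩

theorem isLexIdeal_span_monomial {M : Set (Fin n →₀ ℕ)} (hM : IsUpperSet M)
    (hlex : ∀ u ∈ M, ∀ v : Fin n →₀ ℕ, v.degree = u.degree → toLex u < toLex v → v ∈ M) :
    EGH.IsLexIdeal (Ideal.span ((fun u => monomial u (1 : K)) '' M)) := by
  refine ⟨⟨M, rfl⟩, fun d => ⟨{u | u ∈ M ∧ u.degree = d}, fun u hu => hu.2,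
    fun u hu v hv huv => ⟨hlex u hu.1 v (hv.trans hu.2.symm) huv, hv⟩, ?_⟩⟩
  rw [component_span_monomial]
  simp only [exists_mem_le_iff hM]

/-- There are lex-plus-powers ideals with the Hilbert function of `lppIdeal` in degree `2` and any
prescribed larger value in degree `3`. -/
theorem exists_isLexPlusPowers_hilb_eq {δ t : ℕ} (h1 : (lppExponents n δ 3).ncard ≤ t)
    (h2 : t ≤ {u : Fin n →₀ ℕ | u.degree = 3}.ncard) :
    ∃ P : Ideal (MvPolynomial (Fin n) K), EGH.IsLexPlusPowers (fun _ => 2) P ∧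
      EGH.hilb P 2 = (lppExponents n δ 2).ncard ∧ EGH.hilb P 3 = t := by
  classical
  have hfin : {u : Fin n →₀ ℕ | u.degree = 3}.Finite := Finsupp.finite_of_degree_eq 3
  set D : Finset (Fin n →₀ ℕ) := hfin.toFinset with hD
  have hmemD : ∀ u, u ∈ D ↔ u.degree = 3 := fun u => by rw [hD, Set.Finite.mem_toFinset]; rfl
  let B := D.filter (DvdByLexSegment δ)
  rw [Set.ncard_eq_toFinset_card _ hfin] at h2
  have h1' : (D.filter fun u => u ∈ B ∨ ∃ i, 2 ≤ u i).card ≤ t := by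
    refine le_trans (le_of_eq ?_) h1
    rw [← Set.ncard_coe_finset]
    congr 1
    ext u
    simp only [B, Finset.coe_filter, Finset.mem_filter, hmemD, Set.mem_ofPred_eq, lppExponents]
    constructor
    · rintro ⟨h, ⟨-, h'⟩ | h'⟩
      · exact ⟨Or.inr h', h⟩
      · exact ⟨Or.inl h', h⟩
    · rintro ⟨h' | h', h⟩
      · exact ⟨h, Or.inr h'⟩
      · exact ⟨h, Or.inl ⟨h, h'⟩⟩
  obtain ⟨S, hBS, hSD, hSup, hScard⟩ := exists_upClosed_card_eq (e := fun u => toLex u)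
    (Finset.filter_subset _ D) (fun u hu v hv huv => Finset.mem_filter.2
      ⟨hv, (Finset.mem_filter.1 hu).2.of_toLex_lt huv⟩) (fun u => ∃ i, 2 ≤ u i) h1' h2
  have hS3 : ∀ u ∈ S, u.degree = 3 := fun u hu => (hmemD u).1 (hSD hu)
  -- The lex segment in degree 2, the adjusted set S in degree 3, and everything from degree 4 on.
  -- It is closed under multiples because S contains B, the degree 3 multiples of the segment.
  let M : Set (Fin n →₀ ℕ) :=
    {u | (u.degree = 2 ∧ DvdByLexSegment δ u) ∨ u ∈ S ∨ 4 ≤ u.degree}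
  have hM : IsUpperSet M := by
    intro u v huv hu
    obtain ⟨w, rfl⟩ := exists_add_of_le huv
    have hdeg : (u + w).degree = u.degree + w.degree := map_add _ _ _
    rcases Nat.eq_zero_or_pos w.degree with hw | hw
    · rw [(Finsupp.degree_eq_zero_iff w).1 hw, add_zero]
      exact hu
    · rcases hu with ⟨hu2, hu⟩ | hu | hu
      · by_cases hw1 : w.degree = 1
        · exact Or.inr (Or.inl (hBS (Finset.mem_filter.2 ⟨(hmemD _).2 (by omega), hu.mono huv⟩)))
        · exact Or.inr (Or.inr (by omega))
      · have := hS3 u hu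
        exact Or.inr (Or.inr (by omega))
      · exact Or.inr (Or.inr (by omega))
  have hM2 : ∀ u : Fin n →₀ ℕ, u.degree = 2 → (u ∈ M ↔ DvdByLexSegment δ u) := fun u hu => by
    constructor
    · rintro (h | h | h)
      · exact h.2
      · have := hS3 u h; omega
      · omega
    · exact fun h => Or.inl ⟨hu, h⟩
  have hM3 : ∀ u : Fin n →₀ ℕ, u.degree = 3 → (u ∈ M ↔ u ∈ S) := fun u hu => by
    constructor
    · rintro (h | h | h)
      · omega
      · exact h
      · omega
    · exact fun h => Or.inr (Or.inl h)
  refine ⟨_, ⟨Ideal.span ((fun u => monomial u (1 : K)) '' M),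
    isLexIdeal_span_monomial hM ?_, rfl⟩, ?_, ?_⟩
  · rintro u (⟨hu2, hu⟩ | hu | hu) v hv huv
    · exact Or.inl ⟨hv.trans hu2, hu.of_toLex_lt huv⟩
    · exact Or.inr (Or.inl (hSup u hu v ((hmemD v).2 (hv.trans (hS3 u hu))) huv))
    · exact Or.inr (Or.inr (hv ▸ hu))
  · rw [span_X_sq_sup_span_monomial, hilb_span_monomial, lppExponents]
    congr 1
    ext u
    simp only [Set.mem_ofPred_eq, and_congr_left_iff]
    intro hu
    rw [← hM2 u hu, ← exists_mem_le_iff hM]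
    simp only [Set.mem_union, or_and_right, exists_or, Set.exists_range_iff, single_two_le_iff]
  · rw [span_X_sq_sup_span_monomial, hilb_span_monomial, ← hScard, ← Set.ncard_coe_finset]
    congr 1
    ext u
    simp only [Set.mem_ofPred_eq, Finset.coe_filter, hmemD, and_comm (b := u.degree = 3),
      and_congr_right_iff]
    intro hu
    rw [← hM3 u hu, ← exists_mem_le_iff hM]
    simp only [Set.mem_union, or_and_right, exists_or, Set.exists_range_iff, single_two_le_iff]
    exact or_comm

end LexPlusPowers

theorem mainTheorem3 {K : Type*} [Field K] {n δ : ℕ} (hδ : 2 ≤ δ) (hδn : δ + 1 ≤ n)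
    (f : Fin n → MvPolynomial (Fin n) K) (g : Fin δ → MvPolynomial (Fin n) K)
    (I : Ideal (MvPolynomial (Fin n) K)) (hI : EGH.IsDefectQuadratic f g I)
    (hann : (EGH.linearAnn (Ideal.span (Set.range f)) {p | ∃ j : Fin δ, (j : ℕ) + 1 < δ ∧ p = g j} \
      EGH.linearAnn (Ideal.span (Set.range f)) {g ⟨δ - 1, by omega⟩}).Nonempty) :
    EGH.hilb (EGH.lppIdeal K n δ) 3 ≤ EGH.hilb I 3 ∧
    (EGH.hilb (EGH.lppIdeal K n δ) 3 : ℚ) = (n : ℚ) ^ 2 + n * δ - δ * (δ + 3) / 2 ∧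
    EGH.SatisfiesEGH (fun _ => 2) 2 I := by
  have h3 := ncard_lppExponents_three hδn
  have hI3 := hI.le_hilb_three hδ hδn (Nat.sub_add_cancel (one_le_two.trans hδ)) hann
  have hle : (lppExponents n δ 3).ncard ≤ EGH.hilb I 3 := by omega
  rw [hilb_lppIdeal]
  refine ⟨hle, ?_, ?_⟩
  · have h3' : (2 * (lppExponents n δ 3).ncard + δ * (δ + 3) : ℚ) = 2 * (n * (n + δ)) := by
      exact_mod_cast h3
    linarith
  · obtain ⟨P, hP, hP2, hP3⟩ := exists_isLexPlusPowers_hilb_eq (K := K) hle (hilb_le_ncard I 3)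
    exact ⟨P, hP, by rw [hI.hilb_two, hP2, ncard_lppExponents_two hδn], hP3.symm⟩
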